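/- Let $\mathcal{C}$ be the canonical cubulation of $\mathbb{R}^4$, that is, the decomposition into the translates of the unit cube $[0,1]^4$ by integer vectors. A gridded surface is a subset $N\subset\mathbb{R}^4$ that is a topological $2$-manifold (without boundary) in the subspace topology and is contained in the $2$-skeleton of $\mathcal{C}$. Let $N$ be a gridded surface that is a closed subset of $\mathbb{R}^4$, with $0\in N$. Let the squared-star $\mathcal{F}(N)$ be the union of the $2$-faces of $\mathcal{C}$ that contain $0$ and are contained in $N$, and let the squared-link $\mathrm{slk}(N)$ be its boundary, that is, the union of the edges of $\mathcal{C}$ that are contained in exactly one of these $2$-faces. Let $D=[-1,1]^4$ be the union of the $16$ hypercubes of $\mathcal{C}$ that contain $0$. Then $\mathrm{slk}(N)$ is a simple closed curve, it is contained in the $3$-sphere $\partial D$, and it is unknotted there: some ambient isotopy of $\partial D$ carries $\mathrm{slk}(N)$ onto the boundary of the flat square $[-1,1]^2$ in one of the coordinate planes. Moreover, there is an ambient isotopy $(H_t)_{t\in[0,1]}$ of $\mathbb{R}^4$, with $H_0=\mathrm{id}$, $H_t(0)=0$ and $H_t(D)=D$ for all $t$, such that $H_1$ carries $\mathcal{F}(N)$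 onto the flat square $[-1,1]^2$ in some coordinate plane and $\mathrm{slk}(N)$ onto the boundary of that square. -/

import Mathlib

/-! Cubical faces, gridded surfaces, squared-stars and squared-links in `ℝ⁴`. -/

/-- The face with lowest vertex `v` and edge directions `s` in the canonical cubulation of `ℝᵐ`
(the decomposition into integer translates of the unit cube `[0,1]ᵐ`). Its dimension is the number
of elements of `s`. -/
def cubFace {m : ℕ} (v : Fin m → ℤ) (s : Finset (Fin m)) : Set (EuclideanSpace ℝ (Fin m)) :=
  {x | ∀ i, (v i : ℝ) ≤ x i ∧ x i ≤ (v i : ℝ) + (if i ∈ s then 1 else 0)}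

/-- `F` is a `k`-dimensional face of the canonical cubulation of `ℝᵐ`. -/
def IsCubFace {m : ℕ} (k : ℕ) (F : Set (EuclideanSpace ℝ (Fin m))) : Prop :=
  ∃ (v : Fin m → ℤ) (s : Finset (Fin m)), s.card = k ∧ F = cubFace v s

/-- The `k`-skeleton of the canonical cubulation of `ℝᵐ`. -/
def cubSkeleton (m k : ℕ) : Set (EuclideanSpace ℝ (Fin m)) :=
  ⋃₀ {F | ∃ j ≤ k, IsCubFace j F}

/-- A gridded surface: a subset of `ℝ⁴` that, with the subspace topology, is a topological
`2`-manifold (without boundary), and that is contained in the `2`-skeleton of the canonical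
cubulation. The Hausdorff property and second countability are inherited from `ℝ⁴`. -/
structure IsGriddedSurface (N : Set (EuclideanSpace ℝ (Fin 4))) : Prop where
  manifold : Nonempty (ChartedSpace (EuclideanSpace ℝ (Fin 2)) N)
  subset_skeleton : N ⊆ cubSkeleton 4 2

/-- `F` is one of the square faces of the squared-star of `N` at the origin: a `2`-face of the
cubulation that contains the origin and belongs to `N`. -/
def IsStarFace (N F : Set (EuclideanSpace ℝ (Fin 4))) : Prop :=
  IsCubFace 2 F ∧ (0 : EuclideanSpace ℝ (Fin 4)) ∈ F ∧ F ⊆ N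

/-- The squared-star of `N` at the origin. -/
def squaredStar (N : Set (EuclideanSpace ℝ (Fin 4))) : Set (EuclideanSpace ℝ (Fin 4)) :=
  ⋃₀ {F | IsStarFace N F}

/-- The squared-link of the origin: the boundary of the squared-star, that is, the union of the
edges that lie in exactly one of its square faces. -/
def squaredLink (N : Set (EuclideanSpace ℝ (Fin 4))) : Set (EuclideanSpace ℝ (Fin 4)) :=
  ⋃₀ {e | IsCubFace 1 e ∧ ∃! F, IsStarFace N F ∧ e ⊆ F}

/-- The union `D` of the hypercubes of the cubulation that contain the origin. -/
def cubeNbhd : Set (EuclideanSpace ℝ (Fin 4)) :=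
  ⋃₀ {Q | IsCubFace 4 Q ∧ (0 : EuclideanSpace ℝ (Fin 4)) ∈ Q}

/-- The boundary of `D = [-1,1]⁴`, a `3`-sphere. -/
def cubeSphere : Set (EuclideanSpace ℝ (Fin 4)) := frontier cubeNbhd

/-- The flat square `[-1,1]²` in the coordinate plane spanned by the axes `i` and `j`. -/
def flatSquare (i j : Fin 4) : Set (EuclideanSpace ℝ (Fin 4)) :=
  {x | |x i| ≤ 1 ∧ |x j| ≤ 1 ∧ ∀ k, k ≠ i → k ≠ j → x k = 0}

/-- The boundary (perimeter) of the flat square. -/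
def flatSquareBoundary (i j : Fin 4) : Set (EuclideanSpace ℝ (Fin 4)) :=
  {x | x ∈ flatSquare i j ∧ (|x i| = 1 ∨ |x j| = 1)}

/-- An ambient isotopy of `X`: a family of self-homeomorphisms, parametrized by `[0,1]`, that starts
at the identity and is, together with the family of inverses, jointly continuous. -/
structure AmbientIsotopy (X : Type*) [TopologicalSpace X] where
  homeo : unitInterval → X ≃ₜ X
  continuous_homeo : Continuous fun p : unitInterval × X => homeo p.1 p.2
  continuous_symm : Continuous fun p : unitInterval × X => (homeo p.1).symm p.2
  homeo_zero : homeo 0 = Homeomorph.refl X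

/-- A simple closed curve: the image of an injective continuous map of the circle. -/
def IsSimpleClosedCurve {X : Type*} [TopologicalSpace X] (K : Set X) : Prop :=
  ∃ γ : Circle → X, Continuous γ ∧ Function.Injective γ ∧ Set.range γ = K

/-- A subset `K` of the `3`-sphere `∂D` is unknotted in `∂D` if some ambient isotopy of `∂D` carries
it onto the perimeter of a flat square `[-1,1]²` in a coordinate plane. (The radial projection of
`∂D` onto the round `3`-sphere carries such a perimeter onto a great circle.) -/
def IsUnknotted (K : Set (EuclideanSpace ℝ (Fin 4))) : Prop :=
  K ⊆ cubeSphere ∧ ∃ i j : Fin 4, i ≠ j ∧ ∃ H : AmbientIsotopy cubeSphere,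
    Subtype.val '' (H.homeo 1 '' (Subtype.val ⁻¹' K)) = flatSquareBoundary i j

open Metric Set Topology

/-! ### Invariance of domain in the plane -/

/-! Inside the open cube of sup norm less than `1`, the 2-skeleton is a cone made of coordinate
quadrants. By invariance of domain, the trace of `N` on the interior of a unit square at the origin
is open there. It is also closed, so a square that is met in its interior lies in `N` entirely
(`unitQuad_subset_of_mem`). Near the origin `N` is thus encoded by a graph on the eight directions
`±eᵢ`, whose edges are the squares of `N`.

The manifold condition makes this graph a single cycle (`isDirectionCycle_starGraph`). At a point of
an axis, one square alone would be a half-plane, which is not open in a plane, and two squares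
already fill a neighbourhood, so a third is impossible. At the origin, a punctured disc is
connected, so there is only one cycle.

It remains to flatten the cone over a cycle on the vertices of the cross-polytope. If `b` has
neighbours `a` and `c` that are orthogonal and not adjacent, a shear pushes the quadrants `(a, b)`
and `(b, c)` across an octant onto `(a, c)` and fixes the rest (`supNormIsotopic_push`). Each such
move removes a direction. When none is possible, the cycle is `a, b, -a, -b`, a coordinate plane, or
a triangle, the boundary of an octant, which three moves or inverse moves turn into a coordinate
plane.

The shears are homogeneous, so radial rescaling makes them preserve the sup norm. The squared-star
and the squared-link are the parts of the cone with sup norm at most `1` and equal to `1`; hence one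
isotopy fixes the origin, preserves `D` and `∂D`, and flattens both sets. Its restriction to `∂D`
unknots the link, and its inverse carries a square perimeter to the link. -/

theorem Complex.exists_log_closedBall {h : ℂ → ℂ} (hc : ContinuousOn h (closedBall 0 1))
    (h0 : ∀ z ∈ closedBall (0 : ℂ) 1, h z ≠ 0) :
    ∃ L : ℂ → ℂ, ContinuousOn L (closedBall 0 1) ∧
      ∀ z ∈ closedBall (0 : ℂ) 1, Complex.exp (L z) = h z := by
  -- The radial retraction onto the disc extends `h` to a zero-free map on the whole plane, an open
  -- simply connected set on which logarithms exist.
  let r : ℂ → ℂ := fun z => ((max 1 ‖z‖ : ℝ) : ℂ)⁻¹ * z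
  have hpos : ∀ z : ℂ, 0 < max 1 ‖z‖ := fun z => lt_max_of_lt_left one_pos
  have hr : Continuous r := by
    refine Continuous.mul (Continuous.inv₀ (by fun_prop) fun z => ?_) continuous_id
    exact_mod_cast (hpos z).ne'
  have hrm : ∀ z, r z ∈ closedBall (0 : ℂ) 1 := fun z => by
    simp only [r, mem_closedBall_zero_iff, norm_mul, norm_inv, Complex.norm_real, Real.norm_eq_abs,
      abs_of_pos (hpos z)]
    rw [inv_mul_le_iff₀ (hpos z)]
    simp
  have hrid : ∀ z ∈ closedBall (0 : ℂ) 1, r z = z := fun z hz => by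
    have : max 1 ‖z‖ = 1 := max_eq_left (by simpa using hz)
    simp [r, this]
  have hsc : IsSimplyConnected (univ : Set ℂ) := by
    have := (convex_univ : Convex ℝ (univ : Set ℂ)).contractibleSpace univ_nonempty
    exact (inferInstance : SimplyConnectedSpace (univ : Set ℂ))
  obtain ⟨L, hL, hLe⟩ := Complex.exists_continuousOn_eqOn_exp_comp (X := ℂ) (U := univ)
    (g := h ∘ r) hsc
    isOpen_univ
    ((hc.comp_continuous hr hrm).continuousOn) (by
      rintro ⟨z, -, hz⟩
      exact h0 _ (hrm z) hz)
  refine ⟨L, hL.mono (subset_univ _), fun z hz => ?_⟩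
  have := hLe (mem_univ z)
  simpa [hrid z hz] using this

/-- For such an `L`, the function `L (exp (iθ)) - iθ` lifts the constant `1` through the covering
`exp`, so it is constant; but it changes by `-2πi` from `0` to `2π`. -/
theorem Complex.not_exists_log_sphere :
    ¬ ∃ L : ℂ → ℂ, ContinuousOn L (sphere 0 1) ∧ ∀ z ∈ sphere (0 : ℂ) 1, Complex.exp (L z) = z := by
  rintro ⟨L, hL, hLe⟩
  have hmem : ∀ θ : ℝ, Complex.exp (θ * Complex.I) ∈ sphere (0 : ℂ) 1 := fun θ => by
    simp [Complex.norm_exp_ofReal_mul_I]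
  let φ : ℝ → ℂ := fun θ => L (Complex.exp (θ * Complex.I)) - θ * Complex.I
  have hφ : Continuous φ := by
    refine Continuous.sub (hL.comp_continuous (by fun_prop) hmem) (by fun_prop)
  have hexp : ∀ θ, Complex.exp (φ θ) = 1 := fun θ => by
    simp only [φ, Complex.exp_sub, hLe _ (hmem θ)]
    exact div_self (Complex.exp_ne_zero _)
  have := Complex.isCoveringMap_exp.eq_of_comp_eq hφ (continuous_const (y := φ 0))
    (by ext θ; simp [hexp]) 0 rfl
  have h2 := congrFun this (2 * Real.pi)
  simp [φ] at h2

/-- Without a zero, `h` has a logarithm on the disc. On the circle `h z / z` is within `1` of `1`,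
so its principal logarithm is continuous, and the difference of the two would be a logarithm of `z`.
-/
theorem Complex.exists_zero_of_near_id {h : ℂ → ℂ} (hc : ContinuousOn h (closedBall 0 1))
    (hn : ∀ z ∈ sphere (0 : ℂ) 1, ‖h z - z‖ < 1) : ∃ z ∈ closedBall (0 : ℂ) 1, h z = 0 := by
  by_contra! h0
  obtain ⟨L, hL, hLe⟩ := Complex.exists_log_closedBall hc h0
  refine Complex.not_exists_log_sphere ⟨fun z => L z - Complex.log (h z / z), ?_, ?_⟩
  · refine (hL.mono sphere_subset_closedBall).sub (ContinuousOn.clog ?_ ?_)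
    · refine (hc.mono sphere_subset_closedBall).div continuousOn_id fun z hz => ?_
      rintro rfl; simp at hz
    · intro z hz
      have hz1 : ‖z‖ = 1 := by simpa using hz
      have hz0 : z ≠ 0 := by rintro rfl; simp at hz1
      have : h z / z = 1 + (h z - z) / z := by field_simp; ring
      rw [this]
      exact Complex.mem_slitPlane_of_norm_lt_one (by rw [norm_div, hz1, div_one]; exact hn z hz)
  · intro z hz
    have hz0 : z ≠ 0 := by rintro rfl; simp at hz
    have h0z := h0 z (sphere_subset_closedBall hz)
    rw [Complex.exp_sub, hLe z (sphere_subset_closedBall hz), Complex.exp_log (by positivity)]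
    field_simp

/-- If `f 0` is not interior to the image, there is a point `c` near it off the image. Let `G`
extend the inverse of `f` to the plane. On the image, `G` vanishes only at `f 0`, which is close to
`c`. Pushing the image off the disc about `c` onto its boundary circle, and perturbing `G` so that
it has no zero on that circle, gives a zero-free map of the disc that is close to the identity on
the unit circle. This contradicts `Complex.exists_zero_of_near_id`. -/
theorem Complex.mem_interior_image_closedBall {f : ℂ → ℂ} (hc : ContinuousOn f (closedBall 0 1))
    (hi : InjOn f (closedBall 0 1)) : f 0 ∈ interior (f '' closedBall 0 1) := by
  by_contra hint
  have hK : IsCompact (f '' closedBall 0 1) := (isCompact_closedBall 0 1).image_of_continuousOn hc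
  -- a continuous extension to the plane of the inverse
  obtain ⟨G, hG⟩ : ∃ G : C(ℂ, ℂ), ∀ x ∈ closedBall (0 : ℂ) 1, G (f x) = x := by
    have hfc : Continuous fun x : closedBall (0 : ℂ) 1 => f x :=
      continuousOn_iff_continuous_domRestrict.mp hc
    have he : IsClosedEmbedding fun x : closedBall (0 : ℂ) 1 => f x :=
      hfc.isClosedEmbedding fun x y hxy => Subtype.ext (hi x.2 y.2 hxy)
    obtain ⟨G, hG⟩ := ContinuousMap.exists_extension he
      (⟨Subtype.val, continuous_subtype_val⟩ : C(closedBall (0 : ℂ) 1, ℂ))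
    exact ⟨G, fun x hx => congr($hG ⟨x, hx⟩)⟩
  have h00 : (0 : ℂ) ∈ closedBall (0 : ℂ) 1 := by simp
  have hG0 : G (f 0) = 0 := hG 0 h00
  -- The factor `2` covers all points within `ε` of `c`, as `c` is within `ε` of `f 0`. The image of
  -- the unit circle, where `‖G‖ = 1`, therefore stays outside the disc about `c`.
  obtain ⟨ε, hε, hGε⟩ : ∃ ε > 0, ∀ y, dist y (f 0) < 2 * ε → ‖G y‖ < 1 := by
    obtain ⟨δ, hδ, H⟩ := Metric.continuousAt_iff.mp (G.continuous.continuousAt (x := f 0)) 1 one_pos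
    refine ⟨δ / 2, by positivity, fun y hy => ?_⟩
    have := H (x := y) (by linarith)
    simpa [hG0] using this
  obtain ⟨c, hcK, hcd⟩ : ∃ c, c ∉ f '' closedBall 0 1 ∧ dist c (f 0) < ε := by
    by_contra! H
    refine hint (mem_interior.mpr ⟨ball (f 0) ε, fun y hy => ?_, isOpen_ball, mem_ball_self hε⟩)
    by_contra hy'
    exact absurd (H y hy') (not_le.mpr hy)
  -- a lower bound of the extension away from `c`
  obtain ⟨δ, hδ, hδ1, hGδ⟩ : ∃ δ > 0, δ ≤ 1 ∧
      ∀ y ∈ f '' closedBall 0 1, ε ≤ dist y c → δ ≤ ‖G y‖ := by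
    have hcomp : IsCompact (f '' closedBall 0 1 ∩ {y | ε ≤ dist y c}) :=
      hK.inter_right (isClosed_le continuous_const (by fun_prop))
    rcases (f '' closedBall 0 1 ∩ {y | ε ≤ dist y c}).eq_empty_or_nonempty with he | hne
    · refine ⟨1, one_pos, le_rfl, fun y hy hy' => ?_⟩
      exact absurd (show y ∈ (∅ : Set ℂ) from he ▸ ⟨hy, hy'⟩) (notMem_empty y)
    · obtain ⟨y₀, hy₀, hmin⟩ := hcomp.exists_isMinOn hne
        (f := fun y => ‖G y‖) (by fun_prop)
      refine ⟨min 1 ‖G y₀‖, lt_min one_pos (norm_pos_iff.mpr fun h => ?_), min_le_left _ _,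
        fun y hy hy' => (min_le_right _ _).trans (hmin ⟨hy, hy'⟩)⟩
      obtain ⟨⟨x, hx, rfl⟩, hd⟩ := hy₀
      rw [hG x hx] at h
      subst h
      rw [mem_ofPred_eq, dist_comm] at hd
      linarith
  -- a smooth approximation without zeros on the circle about `c`
  obtain ⟨P, hPc, hPG, hP0⟩ : ∃ P : ℂ → ℂ, Continuous P ∧ (∀ y, ‖P y - G y‖ < δ) ∧
      ∀ y, dist y c = ε → P y ≠ 0 := by
    obtain ⟨Q, hQ, hQG, -⟩ := G.continuous.exists_contDiff_approx 1
      (continuous_const (y := δ / 2)) (fun _ => by positivity)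
    have hsm : ContDiff ℝ 1 fun θ : ℝ => Q (c + ε * Complex.exp (θ * Complex.I)) := by
      refine hQ.comp (contDiff_const.add (contDiff_const.mul (ContDiff.cexp ?_)))
      exact Complex.ofRealCLM.contDiff.mul contDiff_const
    -- A `C¹` curve in the plane omits a dense set of values, so subtracting a small omitted value
    -- `v` removes all zeros on the circle.
    have hd := hsm.dense_compl_range_of_finrank_lt_finrank (by simp)
    obtain ⟨v, hv, hvd⟩ := hd.exists_dist_lt 0 (show 0 < δ / 2 by positivity)
    refine ⟨fun y => Q y - v, hQ.continuous.sub continuous_const, fun y => ?_, fun y hy h => hv ?_⟩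
    · have h1 := hQG y
      rw [dist_eq_norm] at h1
      rw [dist_zero_left] at hvd
      calc ‖Q y - v - G y‖ = ‖(Q y - G y) - v‖ := by ring_nf
        _ ≤ ‖Q y - G y‖ + ‖v‖ := norm_sub_le _ _
        _ < δ := by linarith
    · refine ⟨Complex.arg (y - c), ?_⟩
      have : (ε : ℂ) * Complex.exp (Complex.arg (y - c) * Complex.I) = y - c := by
        rw [← hy, dist_eq_norm]; exact Complex.norm_mul_exp_arg_mul_I _
      simp only [this, add_sub_cancel]
      exact sub_eq_zero.mp h
  -- Radial push from `c`: points closer than `ε` go to the circle of radius `ε`, and the others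
  -- stay.
  let Φ : ℂ → ℂ := fun y => c + ((max (ε / ‖y - c‖) 1 : ℝ) : ℂ) * (y - c)
  have hne : ∀ x ∈ closedBall (0 : ℂ) 1, f x - c ≠ 0 := fun x hx h =>
    hcK ⟨x, hx, sub_eq_zero.mp h⟩
  have hΦfar : ∀ y, y - c ≠ 0 → ε ≤ dist y c → Φ y = y := fun y hy hd => by
    rw [dist_eq_norm] at hd
    have : max (ε / ‖y - c‖) 1 = 1 := max_eq_right ((div_le_one (norm_pos_iff.mpr hy)).mpr hd)
    simp [Φ, this]
  have hΦnear : ∀ y, y - c ≠ 0 → dist y c < ε → dist (Φ y) c = ε := fun y hy hd => by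
    rw [dist_eq_norm] at hd
    have hp := norm_pos_iff.mpr hy
    have : max (ε / ‖y - c‖) 1 = ε / ‖y - c‖ := max_eq_left ((one_le_div hp).mpr hd.le)
    rw [dist_eq_norm]
    simp only [Φ, this, add_sub_cancel_left, norm_mul, Complex.norm_real, norm_div,
      Real.norm_eq_abs, abs_of_pos hε, abs_norm]
    field_simp
  obtain ⟨x, hx, hx0⟩ := Complex.exists_zero_of_near_id (h := fun x => P (Φ (f x))) (by
      refine hPc.comp_continuousOn (continuousOn_const.add (ContinuousOn.mul ?_
        (hc.sub continuousOn_const)))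
      refine Complex.continuous_ofReal.comp_continuousOn (ContinuousOn.sup (ContinuousOn.div
        continuousOn_const (hc.sub continuousOn_const).norm fun x hx => ?_) continuousOn_const)
      exact norm_ne_zero_iff.mpr (hne x hx)) (by
      intro x hx
      have hxb := sphere_subset_closedBall hx
      have hfar : ε ≤ dist (f x) c := by
        by_contra! hlt
        have := hGε (f x) (by linarith [dist_triangle (f x) c (f 0)])
        rw [hG x hxb] at this
        simp at hx
        linarith
      have := hPG (f x)
      rw [hG x hxb] at this
      simp only [hΦfar _ (hne x hxb) hfar]
      linarith)
  rcases le_or_gt ε (dist (f x) c) with hd | hd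
  · simp only [hΦfar _ (hne x hx) hd] at hx0
    have h1 := hPG (f x)
    have h2 := hGδ _ ⟨x, hx, rfl⟩ hd
    rw [hx0, zero_sub, norm_neg] at h1
    linarith
  · exact hP0 _ (hΦnear _ (hne x hx) hd) hx0

/-- Invariance of domain in the plane. -/
theorem Complex.isOpen_image_of_injOn {f : ℂ → ℂ} {U : Set ℂ} (hU : IsOpen U)
    (hc : ContinuousOn f U) (hi : InjOn f U) : IsOpen (f '' U) := by
  rw [isOpen_iff_mem_nhds]
  rintro _ ⟨z, hz, rfl⟩
  obtain ⟨r, hr, hrU⟩ := Metric.nhds_basis_closedBall.mem_iff.mp (hU.mem_nhds hz)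
  have hr' : (r : ℂ) ≠ 0 := by exact_mod_cast hr.ne'
  have hmap : MapsTo (fun x : ℂ => z + r * x) (closedBall 0 1) U := fun x hx => hrU (by
    rw [mem_closedBall_zero_iff] at hx
    simp only [mem_closedBall, dist_self_add_left, norm_mul, Complex.norm_real, Real.norm_eq_abs,
      abs_of_pos hr]
    nlinarith)
  have := Complex.mem_interior_image_closedBall (f := fun x => f (z + r * x))
    (hc.comp (by fun_prop) hmap)
    (hi.comp (fun x _ y _ h => by simpa [hr'] using h) hmap)
  rw [mul_zero, add_zero] at this
  refine Filter.mem_of_superset (mem_interior_iff_mem_nhds.mp this) ?_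
  rintro _ ⟨x, hx, rfl⟩
  exact ⟨_, hmap hx, rfl⟩

theorem isOpen_image_of_injOn_euclideanPlane
    {f : EuclideanSpace ℝ (Fin 2) → EuclideanSpace ℝ (Fin 2)} {U : Set (EuclideanSpace ℝ (Fin 2))}
    (hU : IsOpen U) (hc : ContinuousOn f U) (hi : InjOn f U) : IsOpen (f '' U) := by
  let e := Complex.orthonormalBasisOneI.repr.toHomeomorph
  have h : f '' U = e '' ((e.symm ∘ f ∘ e) '' (e ⁻¹' U)) := by
    rw [image_comp, image_comp, e.image_symm, e.image_preimage, e.image_preimage]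
  rw [h, e.isOpen_image]
  refine Complex.isOpen_image_of_injOn (hU.preimage e.continuous)
    (e.symm.continuous.comp_continuousOn (hc.comp e.continuous.continuousOn fun _ hx => hx)) ?_
  exact e.symm.injective.injOn.comp (hi.comp e.injective.injOn fun _ hx => hx) (mapsTo_univ _ _)

/-! ### Signed coordinates, quadrants and the sup norm -/

/-- The coordinate of `x` in the direction of the signed unit vector `p = (i, ±)`. -/
def signedCoord (p : Fin 4 × Bool) (x : EuclideanSpace ℝ (Fin 4)) : ℝ :=
  if p.2 then x p.1 else -x p.1

/-- The sup norm on `ℝ⁴`. -/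
def supNorm (x : EuclideanSpace ℝ (Fin 4)) : ℝ := ‖WithLp.ofLp x‖

/-- The closed quadrant spanned by the signed unit vectors `p` and `q`. -/
def quadrant (p q : Fin 4 × Bool) : Set (EuclideanSpace ℝ (Fin 4)) :=
  {x | 0 ≤ signedCoord p x ∧ 0 ≤ signedCoord q x ∧ ∀ k, k ≠ p.1 → k ≠ q.1 → x k = 0}

/-- The signed unit vector opposite to `p`. -/
def oppositeDir (p : Fin 4 × Bool) : Fin 4 × Bool := (p.1, !p.2)

/-- The signed unit vector `p`. -/
noncomputable def signedUnit (p : Fin 4 × Bool) : EuclideanSpace ℝ (Fin 4) :=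
  EuclideanSpace.single p.1 (if p.2 then 1 else -1)

theorem continuous_signedCoord (p : Fin 4 × Bool) : Continuous (signedCoord p) := by
  unfold signedCoord; split_ifs <;> fun_prop

@[simp] theorem signedCoord_add (p : Fin 4 × Bool) (x y : EuclideanSpace ℝ (Fin 4)) :
    signedCoord p (x + y) = signedCoord p x + signedCoord p y := by
  unfold signedCoord; split_ifs <;> simp; ring

@[simp] theorem signedCoord_sub (p : Fin 4 × Bool) (x y : EuclideanSpace ℝ (Fin 4)) :
    signedCoord p (x - y) = signedCoord p x - signedCoord p y := by
  unfold signedCoord; split_ifs <;> simp; ring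

@[simp] theorem signedCoord_smul (p : Fin 4 × Bool) (c : ℝ) (x : EuclideanSpace ℝ (Fin 4)) :
    signedCoord p (c • x) = c * signedCoord p x := by
  unfold signedCoord; split_ifs <;> simp

@[simp] theorem signedCoord_neg (p : Fin 4 × Bool) (x : EuclideanSpace ℝ (Fin 4)) :
    signedCoord p (-x) = -signedCoord p x := by
  unfold signedCoord; split_ifs <;> simp

@[simp] theorem signedCoord_zero (p : Fin 4 × Bool) : signedCoord p 0 = 0 := by
  unfold signedCoord; split_ifs <;> simp

theorem apply_signedUnit_of_ne {p : Fin 4 × Bool} {k : Fin 4} (h : k ≠ p.1) :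
    signedUnit p k = 0 := by
  simp [signedUnit, h]

@[simp] theorem signedCoord_signedUnit_self (p : Fin 4 × Bool) :
    signedCoord p (signedUnit p) = 1 := by
  unfold signedCoord signedUnit; split_ifs <;> simp

theorem signedCoord_signedUnit_of_ne {p q : Fin 4 × Bool} (h : p.1 ≠ q.1) :
    signedCoord p (signedUnit q) = 0 := by
  unfold signedCoord; split_ifs <;> simp [apply_signedUnit_of_ne h]

theorem signedCoord_oppositeDir (p : Fin 4 × Bool) (x : EuclideanSpace ℝ (Fin 4)) :
    signedCoord (oppositeDir p) x = -signedCoord p x := by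
  obtain ⟨i, b⟩ := p
  cases b <;> simp [signedCoord, oppositeDir]

theorem signedCoord_eq_zero_iff {p : Fin 4 × Bool} {x : EuclideanSpace ℝ (Fin 4)} :
    signedCoord p x = 0 ↔ x p.1 = 0 := by
  unfold signedCoord; split_ifs <;> simp

theorem abs_signedCoord (p : Fin 4 × Bool) (x : EuclideanSpace ℝ (Fin 4)) :
    |signedCoord p x| = |x p.1| := by
  unfold signedCoord; split_ifs <;> simp

theorem quadrant_comm (p q : Fin 4 × Bool) : quadrant p q = quadrant q p := by
  ext x; simp only [quadrant, mem_ofPred_eq]; tauto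

theorem continuous_supNorm : Continuous supNorm := by
  unfold supNorm; fun_prop

@[simp] theorem supNorm_zero : supNorm 0 = 0 := by simp [supNorm]

theorem supNorm_eq_zero_iff {x : EuclideanSpace ℝ (Fin 4)} : supNorm x = 0 ↔ x = 0 := by
  simp [supNorm]

theorem supNorm_smul (c : ℝ) (x : EuclideanSpace ℝ (Fin 4)) :
    supNorm (c • x) = |c| * supNorm x := by
  simp [supNorm, norm_smul]

theorem supNorm_nonneg (x : EuclideanSpace ℝ (Fin 4)) : 0 ≤ supNorm x := norm_nonneg _

theorem supNorm_le_iff {r : ℝ} (hr : 0 ≤ r) {x : EuclideanSpace ℝ (Fin 4)} :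
    supNorm x ≤ r ↔ ∀ i, |x i| ≤ r := by
  simp [supNorm, pi_norm_le_iff_of_nonneg hr]

theorem supNorm_lt_iff {r : ℝ} (hr : 0 < r) {x : EuclideanSpace ℝ (Fin 4)} :
    supNorm x < r ↔ ∀ i, |x i| < r := by
  simp [supNorm, pi_norm_lt_iff hr]

theorem smul_mem_quadrant {p q : Fin 4 × Bool} {x : EuclideanSpace ℝ (Fin 4)} {c : ℝ} (hc : 0 ≤ c)
    (hx : x ∈ quadrant p q) : c • x ∈ quadrant p q := by
  obtain ⟨h1, h2, h3⟩ := hx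
  refine ⟨?_, ?_, fun k hp hq => by simp [h3 k hp hq]⟩ <;> rw [signedCoord_smul] <;> positivity

/-! ### Isotopies through homeomorphisms that preserve the sup norm -/

/-- `T` is the image of `S` under the end of an ambient isotopy that preserves the sup norm. -/
def SupNormIsotopic (S T : Set (EuclideanSpace ℝ (Fin 4))) : Prop :=
  ∃ H : AmbientIsotopy (EuclideanSpace ℝ (Fin 4)),
    (∀ t x, supNorm (H.homeo t x) = supNorm x) ∧ H.homeo 1 '' S = T

theorem SupNormIsotopic.refl (S : Set (EuclideanSpace ℝ (Fin 4))) : SupNormIsotopic S S :=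
  ⟨⟨fun _ => Homeomorph.refl _, continuous_snd, continuous_snd, rfl⟩, fun _ _ => rfl, by simp⟩

theorem SupNormIsotopic.symm {S T : Set (EuclideanSpace ℝ (Fin 4))} (h : SupNormIsotopic S T) :
    SupNormIsotopic T S := by
  obtain ⟨H, hn, rfl⟩ := h
  refine ⟨⟨fun t => (H.homeo t).symm, H.continuous_symm, H.continuous_homeo, ?_⟩, ?_, ?_⟩
  · rw [H.homeo_zero]; rfl
  · intro t x
    rw [← hn t, Homeomorph.apply_symm_apply]
  · change (H.homeo 1).symm '' _ = _
    rw [← image_comp]; simp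

theorem SupNormIsotopic.trans {S T U : Set (EuclideanSpace ℝ (Fin 4))}
    (h : SupNormIsotopic S T) (h' : SupNormIsotopic T U) : SupNormIsotopic S U := by
  obtain ⟨H, hn, rfl⟩ := h
  obtain ⟨H', hn', rfl⟩ := h'
  refine ⟨⟨fun t => (H.homeo t).trans (H'.homeo t), ?_, ?_, ?_⟩, fun t x => ?_, ?_⟩
  · exact H'.continuous_homeo.comp (continuous_fst.prodMk H.continuous_homeo)
  · exact H.continuous_symm.comp (continuous_fst.prodMk H'.continuous_symm)
  · rw [H.homeo_zero, H'.homeo_zero]; rfl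
  · simp [hn, hn']
  · rw [← image_comp]; rfl

/-- Rescaling of a map so that it preserves the sup norm. -/
noncomputable def rescale (f : EuclideanSpace ℝ (Fin 4) → EuclideanSpace ℝ (Fin 4))
    (x : EuclideanSpace ℝ (Fin 4)) : EuclideanSpace ℝ (Fin 4) := (supNorm x / supNorm (f x)) • f x

theorem supNorm_rescale {f : EuclideanSpace ℝ (Fin 4) → EuclideanSpace ℝ (Fin 4)}
    (hf : ∀ x, f x = 0 → x = 0) (x : EuclideanSpace ℝ (Fin 4)) :
    supNorm (rescale f x) = supNorm x := by
  rcases eq_or_ne x 0 with rfl | hx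
  · simp [rescale]
  have h : supNorm (f x) ≠ 0 := fun h => hx (hf x (supNorm_eq_zero_iff.mp h))
  have := supNorm_nonneg (f x)
  have := supNorm_nonneg x
  rw [rescale, supNorm_smul, abs_of_nonneg (by positivity)]
  field_simp

/-- Homogeneity of `g` pulls the radial factor of `rescale f x` out, and the two factors cancel
because `rescale f` preserves the sup norm. -/
theorem rescale_rescale {f g : EuclideanSpace ℝ (Fin 4) → EuclideanSpace ℝ (Fin 4)}
    (hg : ∀ (c : ℝ) x, 0 ≤ c → g (c • x) = c • g x) (hgf : ∀ x, g (f x) = x)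
    (x : EuclideanSpace ℝ (Fin 4)) : rescale g (rescale f x) = x := by
  rcases eq_or_ne x 0 with rfl | hx
  · simp [rescale]
  have hg0 : g 0 = 0 := by simpa using hg 0 0 le_rfl
  have hf : ∀ x, f x = 0 → x = 0 := fun x h => by rw [← hgf x, h, hg0]
  have h : supNorm (f x) ≠ 0 := fun h => hx (hf x (supNorm_eq_zero_iff.mp h))
  have hx' : supNorm x ≠ 0 := fun h => hx (supNorm_eq_zero_iff.mp h)
  have h1 := supNorm_nonneg (f x)
  have h2 := supNorm_nonneg x
  rw [rescale, supNorm_rescale hf, rescale, hg _ _ (by positivity), hgf, supNorm_smul,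
    abs_of_nonneg (by positivity), smul_smul]
  convert one_smul ℝ x using 2
  field_simp

/-- Away from the origin this is a quotient with nonzero denominator; at the origin continuity
follows from preservation of the sup norm. -/
theorem continuous_rescale {Y : Type*} [TopologicalSpace Y]
    {f : Y → EuclideanSpace ℝ (Fin 4) → EuclideanSpace ℝ (Fin 4)}
    (hf : Continuous fun p : Y × EuclideanSpace ℝ (Fin 4) => f p.1 p.2)
    (h0 : ∀ t x, f t x = 0 → x = 0) :
    Continuous fun p : Y × EuclideanSpace ℝ (Fin 4) => rescale (f p.1) p.2 := by
  rw [continuous_iff_continuousAt]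
  rintro ⟨t, x⟩
  rcases eq_or_ne x 0 with rfl | hx
  · have hr0 : rescale (f t) 0 = 0 := by simp [rescale]
    rw [ContinuousAt, hr0]
    have hc : Continuous fun y : EuclideanSpace ℝ (Fin 4) => WithLp.ofLp y := by fun_prop
    have key : Filter.Tendsto (fun p : Y × EuclideanSpace ℝ (Fin 4) =>
        WithLp.ofLp (rescale (f p.1) p.2)) (𝓝 (t, 0)) (𝓝 0) := by
      rw [tendsto_zero_iff_norm_tendsto_zero]
      have : Filter.Tendsto (fun p : Y × EuclideanSpace ℝ (Fin 4) => supNorm p.2) (𝓝 (t, 0))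
          (𝓝 (supNorm 0)) := (continuous_supNorm.comp continuous_snd).tendsto (t, 0)
      rw [supNorm_zero] at this
      refine this.congr fun p => ?_
      exact (supNorm_rescale (h0 p.1) p.2).symm
    exact ((PiLp.continuous_toLp 2 (fun _ : Fin 4 => ℝ)).tendsto 0).comp key
  · refine ContinuousAt.smul (ContinuousAt.div (continuous_supNorm.comp continuous_snd).continuousAt
      (continuous_supNorm.comp hf).continuousAt fun h => ?_) hf.continuousAt
    exact hx (h0 t x (supNorm_eq_zero_iff.mp h))

/-- A homogeneous family of homeomorphisms carries a cone to a cone that is isotopic to it by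
homeomorphisms that preserve the sup norm. -/
theorem supNormIsotopic_of_homogeneous
    {f g : unitInterval → EuclideanSpace ℝ (Fin 4) → EuclideanSpace ℝ (Fin 4)}
    (hf : Continuous fun p : unitInterval × EuclideanSpace ℝ (Fin 4) => f p.1 p.2)
    (hg : Continuous fun p : unitInterval × EuclideanSpace ℝ (Fin 4) => g p.1 p.2)
    (hfs : ∀ t (c : ℝ) x, 0 ≤ c → f t (c • x) = c • f t x)
    (hgs : ∀ t (c : ℝ) x, 0 ≤ c → g t (c • x) = c • g t x)
    (hgf : ∀ t x, g t (f t x) = x) (hfg : ∀ t x, f t (g t x) = x) (hf0 : ∀ x, f 0 x = x)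
    {S T : Set (EuclideanSpace ℝ (Fin 4))} (hS : ∀ (c : ℝ) x, 0 ≤ c → x ∈ S → c • x ∈ S)
    (hT : ∀ (c : ℝ) x, 0 ≤ c → x ∈ T → c • x ∈ T)
    (hST : MapsTo (f 1) S T) (hTS : MapsTo (g 1) T S) : SupNormIsotopic S T := by
  have hf00 : ∀ t x, f t x = 0 → x = 0 := fun t x h => by
    rw [← hgf t x, h]; simpa using hgs t 0 0 le_rfl
  have hg00 : ∀ t x, g t x = 0 → x = 0 := fun t x h => by
    rw [← hfg t x, h]; simpa using hfs t 0 0 le_rfl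
  have hcf := continuous_rescale hf hf00
  have hcg := continuous_rescale hg hg00
  have hcf' : ∀ t, Continuous (rescale (f t)) := fun t => by
    have h : Continuous fun x : EuclideanSpace ℝ (Fin 4) => (t, x) := by fun_prop
    simpa only [Function.comp_def] using hcf.comp h
  have hcg' : ∀ t, Continuous (rescale (g t)) := fun t => by
    have h : Continuous fun x : EuclideanSpace ℝ (Fin 4) => (t, x) := by fun_prop
    simpa only [Function.comp_def] using hcg.comp h
  refine ⟨⟨fun t => ⟨⟨rescale (f t), rescale (g t), rescale_rescale (hgs t) (hgf t),
    rescale_rescale (hfs t) (hfg t)⟩, hcf' t, hcg' t⟩, hcf, hcg, ?_⟩,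
    fun t => supNorm_rescale (hf00 t), ?_⟩
  · ext1 x
    change rescale (f 0) x = x
    rcases eq_or_ne x 0 with rfl | hx
    · simp [rescale]
    · have : supNorm x ≠ 0 := fun h => hx (supNorm_eq_zero_iff.mp h)
      rw [rescale, hf0, div_self this, one_smul]
  -- The rescaling factors are nonnegative, so cones absorb them.
  · have hq : ∀ x y, 0 ≤ supNorm x / supNorm y := fun x y =>
      div_nonneg (supNorm_nonneg x) (supNorm_nonneg y)
    change rescale (f 1) '' S = T
    refine Subset.antisymm ?_ fun y hy => ⟨rescale (g 1) y, hS _ _ (hq _ _) (hTS hy),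
      rescale_rescale (hfs 1) (hfg 1) y⟩
    rintro _ ⟨x, hx, rfl⟩
    exact hT _ _ (hq _ _) (hST hx)

/-! ### Pushing two quadrants across an octant -/

/-- The profile of the shear that pushes the quadrants `(a, b)` and `(b, c)` onto `(a, c)`. -/
noncomputable def pushProfile (a b c : Fin 4 × Bool) (x : EuclideanSpace ℝ (Fin 4)) : ℝ :=
  max 0 (min (signedCoord a x + signedCoord b x) (signedCoord c x + signedCoord b x))

theorem continuous_pushProfile (a b c : Fin 4 × Bool) : Continuous (pushProfile a b c) := by
  have := continuous_signedCoord a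
  have := continuous_signedCoord b
  have := continuous_signedCoord c
  unfold pushProfile; fun_prop

theorem pushProfile_smul (a b c : Fin 4 × Bool) {r : ℝ} (hr : 0 ≤ r)
    (x : EuclideanSpace ℝ (Fin 4)) : pushProfile a b c (r • x) = r * pushProfile a b c x := by
  simp only [pushProfile, signedCoord_smul, ← mul_add, mul_max_of_nonneg _ _ hr,
    mul_min_of_nonneg _ _ hr, mul_zero]

/-- The shear moves along `v = a - b + c`, and the profile is constant along `v`, so reversing the
sign inverts it. On the quadrants `(a, b)` and `(b, c)` the profile is the `b`-coordinate, so time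
`1` brings that coordinate to `0` and lands in `(a, c)`. The hypothesis `hfix` makes the profile
vanish on `T`. -/
theorem supNormIsotopic_push {a b c : Fin 4 × Bool} (hab : a.1 ≠ b.1) (hbc : b.1 ≠ c.1)
    (hac : a.1 ≠ c.1) {T : Set (EuclideanSpace ℝ (Fin 4))}
    (hT : ∀ (r : ℝ) x, 0 ≤ r → x ∈ T → r • x ∈ T)
    (hfix : ∀ x ∈ T, signedCoord b x ≤ 0 ∧ (signedCoord a x ≤ 0 ∨ signedCoord c x ≤ 0)) :
    SupNormIsotopic (T ∪ (quadrant a b ∪ quadrant b c)) (T ∪ quadrant a c) := by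
  set v := signedUnit a - signedUnit b + signedUnit c with hv
  have ha : signedCoord a v = 1 := by
    simp [hv, signedCoord_signedUnit_of_ne hab, signedCoord_signedUnit_of_ne hac]
  have hb : signedCoord b v = -1 := by
    simp [hv, signedCoord_signedUnit_of_ne hab.symm, signedCoord_signedUnit_of_ne hbc]
  have hc : signedCoord c v = 1 := by
    simp [hv, signedCoord_signedUnit_of_ne hac.symm, signedCoord_signedUnit_of_ne hbc.symm]
  have hd : ∀ k, k ≠ a.1 → k ≠ b.1 → k ≠ c.1 → v k = 0 := fun k h1 h2 h3 => by
    simp [hv, apply_signedUnit_of_ne h1, apply_signedUnit_of_ne h2, apply_signedUnit_of_ne h3]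
  have hinv : ∀ x (s : ℝ), pushProfile a b c (x + s • v) = pushProfile a b c x := fun x s => by
    simp only [pushProfile, signedCoord_add, signedCoord_smul, ha, hb, hc]
    congr 2 <;> ring
  have hcont := continuous_pushProfile a b c
  have hT0 : ∀ x ∈ T, pushProfile a b c x = 0 := fun x hx => by
    obtain ⟨h1, h2⟩ := hfix x hx
    refine max_eq_left ?_
    rcases h2 with h2 | h2
    · exact (min_le_left _ _).trans (by linarith)
    · exact (min_le_right _ _).trans (by linarith)
  refine supNormIsotopic_of_homogeneous
    (f := fun t x => x + ((t : ℝ) * pushProfile a b c x) • v)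
    (g := fun t x => x + (-((t : ℝ) * pushProfile a b c x)) • v)
    (by fun_prop) (by fun_prop) ?_ ?_ ?_ ?_ ?_ ?_ ?_ ?_ ?_
  · intro t r x hr
    rw [pushProfile_smul a b c hr]; module
  · intro t r x hr
    rw [pushProfile_smul a b c hr]; module
  · intro t x
    simp only [hinv]; module
  · intro t x
    simp only [hinv]; module
  · intro x; simp
  · rintro r x hr (h | h | h)
    · exact Or.inl (hT r x hr h)
    · exact Or.inr (Or.inl (smul_mem_quadrant hr h))
    · exact Or.inr (Or.inr (smul_mem_quadrant hr h))
  · rintro r x hr (h | h)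
    · exact Or.inl (hT r x hr h)
    · exact Or.inr (smul_mem_quadrant hr h)
  · rintro x (h | h)
    · left; simpa [hT0 x h] using h
    · have hz : ∀ k, k ≠ a.1 → k ≠ b.1 → k ≠ c.1 → x k = 0 := by
        rcases h with h | h <;> intro k h1 h2 h3
        exacts [h.2.2 k h1 h2, h.2.2 k h2 h3]
      have hμ : pushProfile a b c x = signedCoord b x ∧ 0 ≤ signedCoord a x ∧
          0 ≤ signedCoord b x ∧ 0 ≤ signedCoord c x := by
        rcases h with ⟨h1, h2, h3⟩ | ⟨h1, h2, h3⟩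
        · have h4 : signedCoord c x = 0 := signedCoord_eq_zero_iff.mpr (h3 _ hac.symm hbc.symm)
          refine ⟨?_, h1, h2, h4.ge⟩
          rw [pushProfile, h4, min_eq_right (by linarith), max_eq_right (by linarith), zero_add]
        · have h4 : signedCoord a x = 0 := signedCoord_eq_zero_iff.mpr (h3 _ hab hac)
          refine ⟨?_, h4.ge, h1, h2⟩
          rw [pushProfile, h4, min_eq_left (by linarith), max_eq_right (by linarith), zero_add]
      obtain ⟨hμ, h1, h2, h3⟩ := hμ
      right
      refine ⟨?_, ?_, fun k hk1 hk2 => ?_⟩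
      · simp [ha, hμ]; linarith
      · simp [hc, hμ]; linarith
      · rcases eq_or_ne k b.1 with rfl | hk
        · rw [← signedCoord_eq_zero_iff]
          simp [hb, hμ]
        · simp [hz k hk1 hk hk2, hd k hk1 hk hk2]
  · rintro x (h | h)
    · left; simpa [hT0 x h] using h
    · right
      obtain ⟨h1, h2, h3⟩ := h
      have h4 : signedCoord b x = 0 := signedCoord_eq_zero_iff.mpr (h3 _ hab.symm hbc)
      -- Going back subtracts the smaller of the `a`- and `c`-coordinates; the one that becomes `0`
      -- decides which of the two quadrants is reached.
      have hμ : pushProfile a b c x = min (signedCoord a x) (signedCoord c x) := by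
        rw [pushProfile, h4, add_zero, add_zero, max_eq_right (le_min h1 h2)]
      have hz : ∀ k, k ≠ a.1 → k ≠ b.1 → k ≠ c.1 →
          (x + (-(((1 : unitInterval) : ℝ) * pushProfile a b c x)) • v) k = 0 :=
        fun k h5 h6 h7 => by simp [h3 k h5 h7, hd k h5 h6 h7]
      have hb0 : 0 ≤ signedCoord b (x + (-(((1 : unitInterval) : ℝ) * pushProfile a b c x)) • v) := by
        simp [hb, hμ, h4, h1, h2]
      rcases le_total (signedCoord c x) (signedCoord a x) with hle | hle
      · left
        refine ⟨?_, hb0, fun k h5 h6 => ?_⟩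
        · simp [ha, hμ, hle]
        · rcases eq_or_ne k c.1 with rfl | hk
          · rw [← signedCoord_eq_zero_iff]
            simp [hc, hμ, hle]
          · exact hz k h5 h6 hk
      · right
        refine ⟨hb0, ?_, fun k h5 h6 => ?_⟩
        · simp [hc, hμ, hle]
        · rcases eq_or_ne k a.1 with rfl | hk
          · rw [← signedCoord_eq_zero_iff]
            simp [ha, hμ, hle]
          · exact hz k hk h5 h6

/-! ### Unions of quadrants along a cycle of directions -/

/-- Any further direction is either opposite to a spanning one or along an axis on which the
quadrant vanishes. In this way positive coordinates detect the spanning directions of a quadrant. -/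
theorem signedCoord_nonpos_of_mem_quadrant {p q r : Fin 4 × Bool} (hrp : r ≠ p)
    (hrq : r ≠ q) {x : EuclideanSpace ℝ (Fin 4)} (hx : x ∈ quadrant p q) : signedCoord r x ≤ 0 := by
  have key : ∀ s : Fin 4 × Bool, r ≠ s → r.1 = s.1 → signedCoord r x = -signedCoord s x := by
    rintro ⟨i, b⟩ h h'
    obtain ⟨j, b'⟩ := r
    obtain rfl : j = i := h'
    cases b <;> cases b' <;> simp_all [signedCoord]
  by_cases h1 : r.1 = p.1
  · rw [key p hrp h1]; linarith [hx.1]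
  by_cases h2 : r.1 = q.1
  · rw [key q hrq h2]; linarith [hx.2.1]
  · exact (signedCoord_eq_zero_iff.mpr (hx.2.2 _ h1 h2)).le

theorem eq_oppositeDir {p q : Fin 4 × Bool} (h : p.1 = q.1) (h' : p ≠ q) : q = oppositeDir p := by
  obtain ⟨i, x⟩ := p
  obtain ⟨j, y⟩ := q
  cases x <;> cases y <;> simp_all [oppositeDir]

/-- The union of the quadrants spanned by the pairs of directions in `E`. -/
def quadrantUnion (E : Set ((Fin 4 × Bool) × (Fin 4 × Bool))) : Set (EuclideanSpace ℝ (Fin 4)) :=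
  {x | ∃ e ∈ E, x ∈ quadrant e.1 e.2}

/-- Combinatorial form of the push: a quadrant that does not use `b` has nonpositive `b`-coordinate,
and one not spanned by `a` and `c` cannot have both of these coordinates positive. -/
theorem supNormIsotopic_quadrantUnion_push {a b c : Fin 4 × Bool} (hab : a.1 ≠ b.1)
    (hbc : b.1 ≠ c.1) (hac : a.1 ≠ c.1) {E : Set ((Fin 4 × Bool) × (Fin 4 × Bool))}
    (hE : ∀ p q, (p, q) ∈ E → p.1 ≠ q.1 ∧ p ≠ b ∧ q ≠ b ∧ ¬(p = a ∧ q = c) ∧ ¬(p = c ∧ q = a)) :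
    SupNormIsotopic (quadrantUnion (E ∪ {(a, b), (b, c)})) (quadrantUnion (E ∪ {(a, c)})) := by
  have h1 : quadrantUnion (E ∪ {(a, b), (b, c)}) =
      quadrantUnion E ∪ (quadrant a b ∪ quadrant b c) := by
    ext x
    simp only [quadrantUnion, mem_union, mem_insert_iff, mem_singleton_iff, or_and_right, exists_or,
      exists_eq_left, mem_ofPred_eq]
  have h2 : quadrantUnion (E ∪ {(a, c)}) = quadrantUnion E ∪ quadrant a c := by
    ext x
    simp only [quadrantUnion, mem_union, mem_singleton_iff, or_and_right, exists_or,
      exists_eq_left, mem_ofPred_eq]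
  rw [h1, h2]
  refine supNormIsotopic_push hab hbc hac ?_ ?_
  · rintro r x hr ⟨e, he, hx⟩
    exact ⟨e, he, smul_mem_quadrant hr hx⟩
  · rintro x ⟨⟨p, q⟩, he, hx⟩
    obtain ⟨h3, h4, h5, h6, h7⟩ := hE p q he
    refine ⟨signedCoord_nonpos_of_mem_quadrant h4.symm h5.symm hx, ?_⟩
    by_contra! h
    have ha : a = p ∨ a = q := by
      by_contra! h'
      linarith [signedCoord_nonpos_of_mem_quadrant h'.1 h'.2 hx]
    have hc : c = p ∨ c = q := by
      by_contra! h'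
      linarith [signedCoord_nonpos_of_mem_quadrant h'.1 h'.2 hx]
    grind

/-- The coordinate plane spanned by the axes `i` and `j`. -/
def coordPlane (i j : Fin 4) : Set (EuclideanSpace ℝ (Fin 4)) :=
  {x | ∀ k, k ≠ i → k ≠ j → x k = 0}

theorem quadrantUnion_eq_coordPlane (a b : Fin 4 × Bool) :
    quadrantUnion {(a, b), (b, oppositeDir a), (oppositeDir a, oppositeDir b), (oppositeDir b, a)} =
      coordPlane a.1 b.1 := by
  ext x
  simp only [quadrantUnion, coordPlane, mem_ofPred_eq, mem_insert_iff, mem_singleton_iff,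
    exists_eq_or_imp, exists_eq_left, quadrant, signedCoord_oppositeDir]
  simp only [oppositeDir]
  constructor
  · rintro (h | h | h | h) k h1 h2
    exacts [h.2.2 k h1 h2, h.2.2 k h2 h1, h.2.2 k h1 h2, h.2.2 k h2 h1]
  · intro h
    have h' : ∀ k, k ≠ b.1 → k ≠ a.1 → x k = 0 := fun k h1 h2 => h k h2 h1
    rcases le_total 0 (signedCoord a x) with h1 | h1 <;>
    rcases le_total 0 (signedCoord b x) with h2 | h2
    · exact Or.inl ⟨h1, h2, h⟩
    · exact Or.inr (Or.inr (Or.inr ⟨neg_nonneg.mpr h2, h1, h'⟩))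
    · exact Or.inr (Or.inl ⟨h2, neg_nonneg.mpr h1, h'⟩)
    · exact Or.inr (Or.inr (Or.inl ⟨neg_nonneg.mpr h1, neg_nonneg.mpr h2, h⟩))

theorem quadrantUnion_congr {E F : Set ((Fin 4 × Bool) × (Fin 4 × Bool))}
    (h : ∀ p q, (p, q) ∈ E ∨ (q, p) ∈ E ↔ (p, q) ∈ F ∨ (q, p) ∈ F) :
    quadrantUnion E = quadrantUnion F := by
  ext x
  constructor
  · rintro ⟨⟨p, q⟩, he, hx⟩
    rcases (h p q).mp (Or.inl he) with h' | h'
    · exact ⟨_, h', hx⟩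
    · exact ⟨_, h', by rwa [quadrant_comm]⟩
  · rintro ⟨⟨p, q⟩, he, hx⟩
    rcases (h p q).mpr (Or.inl he) with h' | h'
    · exact ⟨_, h', hx⟩
    · exact ⟨_, h', by rwa [quadrant_comm]⟩

/-- The triangle is first enlarged: `b, c` becomes `b, -a, c`, and `c, a` becomes `c, -b, a`. Then
`-a, c, -b` is shortened to `-a, -b`, which leaves the cycle `a, b, -a, -b`. -/
theorem supNormIsotopic_octant_boundary {a b c : Fin 4 × Bool} (hab : a.1 ≠ b.1)
    (hbc : b.1 ≠ c.1) (hac : a.1 ≠ c.1) :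
    SupNormIsotopic (quadrantUnion {(a, b), (b, c), (c, a)}) (coordPlane a.1 b.1) := by
  have hopp : ∀ p : Fin 4 × Bool, (oppositeDir p).1 = p.1 := fun p => rfl
  have hoppne : ∀ p : Fin 4 × Bool, oppositeDir p ≠ p := fun p h => by
    have := congrArg Prod.snd h
    simp [oppositeDir] at this
  have h1 := supNormIsotopic_quadrantUnion_push (a := b) (b := oppositeDir a) (c := c) hab.symm
    hac hbc (E := {(a, b), (c, a)}) (by
      have := hopp a; have := hoppne a; grind)
  have h2 := supNormIsotopic_quadrantUnion_push (a := c) (b := oppositeDir b) (c := a) hbc.symm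
    hab.symm hac.symm (E := {(a, b), (b, oppositeDir a), (oppositeDir a, c)}) (by
      have := hopp a; have := hoppne a; have := hopp b; have := hoppne b; grind)
  have h3 := supNormIsotopic_quadrantUnion_push (a := oppositeDir a) (b := c) (c := oppositeDir b)
    hac hbc.symm hab (E := {(a, b), (b, oppositeDir a), (oppositeDir b, a)}) (by
      have := hopp a; have := hoppne a; have := hopp b; have := hoppne b; grind)
  rw [← quadrantUnion_eq_coordPlane]
  have e1 : quadrantUnion {(a, b), (b, c), (c, a)} = quadrantUnion ({(a, b), (c, a)} ∪ {(b, c)}) :=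
    quadrantUnion_congr (by grind)
  have e2 : quadrantUnion ({(a, b), (c, a)} ∪ {(b, oppositeDir a), (oppositeDir a, c)}) =
      quadrantUnion ({(a, b), (b, oppositeDir a), (oppositeDir a, c)} ∪ {(c, a)}) :=
    quadrantUnion_congr (by grind)
  have e3 : quadrantUnion ({(a, b), (b, oppositeDir a), (oppositeDir a, c)} ∪
        {(c, oppositeDir b), (oppositeDir b, a)}) =
      quadrantUnion ({(a, b), (b, oppositeDir a), (oppositeDir b, a)} ∪
        {(oppositeDir a, c), (c, oppositeDir b)}) :=
    quadrantUnion_congr (by grind)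
  have e4 : quadrantUnion ({(a, b), (b, oppositeDir a), (oppositeDir b, a)} ∪
        {(oppositeDir a, oppositeDir b)}) =
      quadrantUnion {(a, b), (b, oppositeDir a), (oppositeDir a, oppositeDir b),
        (oppositeDir b, a)} :=
    quadrantUnion_congr (by grind)
  rw [e1]
  refine h1.symm.trans ?_
  rw [e2]
  refine h2.symm.trans ?_
  rw [e3, ← e4]
  exact h3

/-- The edges of `G` form a single cycle of directions, in which consecutive directions are
orthogonal. -/
structure IsDirectionCycle (G : SimpleGraph (Fin 4 × Bool)) : Prop where
  fst_ne : ∀ {p q}, G.Adj p q → p.1 ≠ q.1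
  exists_other : ∀ {p q}, G.Adj p q → ∃ r, r ≠ q ∧ ∀ s, G.Adj p s ↔ s = q ∨ s = r
  -- Only directions that carry an edge are compared, since unused directions are isolated vertices
  -- of `G`.
  connected : ∀ S : Set (Fin 4 × Bool), (∀ p q, p ∈ S → G.Adj p q → q ∈ S) →
    ∀ {p q r s}, G.Adj p q → G.Adj r s → p ∈ S → r ∈ S
  exists_adj : ∃ p q, G.Adj p q

/-- The graph `G` with the path `a`, `b`, `c` replaced by the edge from `a` to `c`. -/
def shortcutGraph (G : SimpleGraph (Fin 4 × Bool)) (a b c : Fin 4 × Bool) (hac : a ≠ c) :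
    SimpleGraph (Fin 4 × Bool) where
  Adj p q := (G.Adj p q ∧ p ≠ b ∧ q ≠ b) ∨ (p = a ∧ q = c) ∨ (p = c ∧ q = a)
  symm := ⟨fun p q h => by have := G.adj_comm p q; tauto⟩
  loopless := ⟨fun p h => by
    rcases h with h | h | h
    · exact G.loopless.irrefl p h.1
    · exact hac (h.1.symm.trans h.2)
    · exact hac (h.2.symm.trans h.1)⟩

/-- Only `a` and `c` change neighbours: each trades `b` for the other. Since they were not adjacent
before, both keep exactly two neighbours. -/
theorem IsDirectionCycle.shortcutGraph {G : SimpleGraph (Fin 4 × Bool)} (hG : IsDirectionCycle G)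
    {a b c : Fin 4 × Bool} (hac : a.1 ≠ c.1) (hb : ∀ s, G.Adj b s ↔ s = a ∨ s = c)
    (hnadj : ¬ G.Adj a c) :
    IsDirectionCycle (shortcutGraph G a b c (fun h => hac (congrArg Prod.fst h))) := by
  have hne : a ≠ c := fun h => hac (congrArg Prod.fst h)
  have hba : G.Adj b a := (hb a).mpr (Or.inl rfl)
  have hbc : G.Adj b c := (hb c).mpr (Or.inr rfl)
  have hab := hba.symm
  have hcb := hbc.symm
  have hnadj' : ¬ G.Adj c a := fun h => hnadj h.symm
  have hb' : ∀ s, G.Adj s b ↔ s = a ∨ s = c := fun s => by rw [G.adj_comm]; exact hb s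
  have hab' := hab.ne
  have hcb' := hcb.ne
  refine ⟨?_, ?_, ?_, ⟨a, c, Or.inr (Or.inl ⟨rfl, rfl⟩)⟩⟩
  · rintro p q (h | ⟨rfl, rfl⟩ | ⟨rfl, rfl⟩)
    exacts [hG.fst_ne h.1, hac, hac.symm]
  · obtain ⟨ra, hra, hra'⟩ := hG.exists_other hab
    obtain ⟨rc, hrc, hrc'⟩ := hG.exists_other hcb
    rintro p q h
    change (G.Adj p q ∧ p ≠ b ∧ q ≠ b) ∨ (p = a ∧ q = c) ∨ (p = c ∧ q = a) at h
    change ∃ r, r ≠ q ∧ ∀ s, (G.Adj p s ∧ p ≠ b ∧ s ≠ b) ∨ (p = a ∧ s = c) ∨ (p = c ∧ s = a) ↔ _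
    by_cases hpa : p = a
    · subst hpa
      by_cases hqc : q = c
      · exact ⟨ra, by grind, fun s => by grind⟩
      · exact ⟨c, by grind, fun s => by grind⟩
    by_cases hpc : p = c
    · subst hpc
      by_cases hqa : q = a
      · exact ⟨rc, by grind, fun s => by grind⟩
      · exact ⟨a, by grind, fun s => by grind⟩
    obtain ⟨r, hr, hr'⟩ := hG.exists_other (p := p) (q := q) (by tauto)
    exact ⟨r, hr, fun s => by grind⟩
  · intro S hS p q r s hpq hrs hp
    change ∀ p q, p ∈ S → (G.Adj p q ∧ p ≠ b ∧ q ≠ b) ∨ (p = a ∧ q = c) ∨ (p = c ∧ q = a) → _ at hS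
    change (G.Adj p q ∧ p ≠ b ∧ q ≠ b) ∨ (p = a ∧ q = c) ∨ (p = c ∧ q = a) at hpq
    change (G.Adj r s ∧ r ≠ b ∧ s ≠ b) ∨ (r = a ∧ s = c) ∨ (r = c ∧ s = a) at hrs
    have hac' : a ∈ S ↔ c ∈ S := ⟨fun h => hS a c h (by tauto), fun h => hS c a h (by tauto)⟩
    have hpq' : ∃ q', G.Adj p q' := by grind
    have hrs' : ∃ s', G.Adj r s' := by grind
    have hrb : r ≠ b := by grind
    have hpb : p ≠ b := by grind
    obtain ⟨q', hq'⟩ := hpq'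
    obtain ⟨s', hs'⟩ := hrs'
    -- A closed set of the new graph becomes closed in `G` once `b` is put in exactly when `a`,
    -- equivalently `c`, is in.
    have := hG.connected {x | (x ∈ S ∧ x ≠ b) ∨ (x = b ∧ a ∈ S)} (by
      intro x y hx hxy
      simp only [mem_ofPred_eq] at hx ⊢
      grind) hq' hs' (Or.inl ⟨hp, hpb⟩)
    simp only [mem_ofPred_eq] at this
    tauto

/-- The remaining edges avoid `b` and, because `a` and `c` are not adjacent, differ from the new
edge; this is what the push needs to fix them. -/
theorem supNormIsotopic_shortcutGraph {G : SimpleGraph (Fin 4 × Bool)}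
    (hG : ∀ {p q}, G.Adj p q → p.1 ≠ q.1) {a b c : Fin 4 × Bool} (hac : a.1 ≠ c.1)
    (hb : ∀ s, G.Adj b s ↔ s = a ∨ s = c) (hnadj : ¬ G.Adj a c) :
    SupNormIsotopic (quadrantUnion {e | G.Adj e.1 e.2}) (quadrantUnion
      {e | (shortcutGraph G a b c (fun h => hac (congrArg Prod.fst h))).Adj e.1 e.2}) := by
  have hba : G.Adj b a := (hb a).mpr (Or.inl rfl)
  have hbc : G.Adj b c := (hb c).mpr (Or.inr rfl)
  have hpush := supNormIsotopic_quadrantUnion_push (hG hba).symm (hG hbc) hac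
    (E := {e | G.Adj e.1 e.2 ∧ e.1 ≠ b ∧ e.2 ≠ b}) (by
      rintro p q ⟨h1, h2, h3⟩
      refine ⟨hG h1, h2, h3, ?_, ?_⟩
      · rintro ⟨rfl, rfl⟩; exact hnadj h1
      · rintro ⟨rfl, rfl⟩; exact hnadj h1.symm)
  convert hpush using 1
  · refine quadrantUnion_congr fun p q => ?_
    simp only [mem_ofPred_eq, mem_union, mem_insert_iff, mem_singleton_iff, Prod.mk.injEq]
    constructor
    · intro h
      have h : G.Adj p q := h.elim id fun h => h.symm
      by_cases hp : p = b
      · subst hp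
        rcases (hb q).mp h with rfl | rfl
        · exact Or.inr (Or.inr (Or.inl ⟨rfl, rfl⟩))
        · exact Or.inl (Or.inr (Or.inr ⟨rfl, rfl⟩))
      by_cases hq : q = b
      · subst hq
        rcases (hb p).mp h.symm with rfl | rfl
        · exact Or.inl (Or.inr (Or.inl ⟨rfl, rfl⟩))
        · exact Or.inr (Or.inr (Or.inr ⟨rfl, rfl⟩))
      · exact Or.inl (Or.inl ⟨h, hp, hq⟩)
    · rintro ((h | ⟨rfl, rfl⟩ | ⟨rfl, rfl⟩) | (h | ⟨rfl, rfl⟩ | ⟨rfl, rfl⟩))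
      exacts [Or.inl h.1, Or.inr hba, Or.inl hbc, Or.inr h.1, Or.inl hba, Or.inr hbc]
  · refine quadrantUnion_congr fun p q => ?_
    change ((G.Adj p q ∧ p ≠ b ∧ q ≠ b) ∨ (p = a ∧ q = c) ∨ (p = c ∧ q = a)) ∨
      ((G.Adj q p ∧ q ≠ b ∧ p ≠ b) ∨ (q = a ∧ p = c) ∨ (q = c ∧ p = a)) ↔ _
    simp only [mem_ofPred_eq, mem_union, mem_singleton_iff, Prod.mk.injEq]
    tauto

/-- Let `a`, `c` be the neighbours of some `b`. If they lie on different axes they are adjacent, and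
the cycle is a triangle. Otherwise `c = -a`, and irreducibility at `a` and at `c` forces the other
neighbour of each to be `-b`, so the cycle is `a, b, -a, -b`. -/
theorem IsDirectionCycle.supNormIsotopic_of_irreducible {G : SimpleGraph (Fin 4 × Bool)}
    (hG : IsDirectionCycle G)
    (hred : ∀ a b c, a.1 ≠ c.1 → (∀ s, G.Adj b s ↔ s = a ∨ s = c) → G.Adj a c) : ∃ i j, i ≠ j ∧
      SupNormIsotopic (quadrantUnion {e | G.Adj e.1 e.2}) (coordPlane i j) := by
  obtain ⟨b, a, hba⟩ := hG.exists_adj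
  obtain ⟨c, hca, hb⟩ := hG.exists_other hba
  have hbc : G.Adj b c := (hb c).mpr (Or.inr rfl)
  have hcl : ∀ {S : Set (Fin 4 × Bool)}, b ∈ S → (∀ p q, p ∈ S → G.Adj p q → q ∈ S) →
      ∀ p q, G.Adj p q → p ∈ S ∧ q ∈ S := fun hbS hS p q hpq =>
    ⟨hG.connected _ hS hba hpq hbS, hG.connected _ hS hba hpq.symm hbS⟩
  by_cases hac : a.1 = c.1
  · have hc : c = oppositeDir a := eq_oppositeDir hac hca.symm
    have hother : ∀ p, G.Adj p b → p = a ∨ p = c →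
        ∀ s, G.Adj p s ↔ s = b ∨ s = oppositeDir b := by
      intro p hp hpac
      obtain ⟨d, hdb, hd⟩ := hG.exists_other hp
      have : b.1 = d.1 := by
        by_contra hbd
        have hbd' := hred b p d hbd hd
        rw [hb] at hbd'
        have := hG.fst_ne ((hd d).mpr (Or.inr rfl))
        grind
      rwa [← eq_oppositeDir this hdb.symm]
    have ha := hother a hba.symm (Or.inl rfl)
    have hc' := hother c hbc.symm (Or.inr rfl)
    obtain ⟨d, hd, hob⟩ := hG.exists_other ((ha _).mpr (Or.inr rfl)).symm
    have hdc : c = d := by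
      have := (hob c).mp ((hc' _).mpr (Or.inr rfl)).symm
      tauto
    subst hdc
    have hall := hcl (S := {a, b, c, oppositeDir b}) (by simp) (by
      intro p q hp hpq
      simp only [mem_insert_iff, mem_singleton_iff] at hp ⊢
      grind)
    refine ⟨a.1, b.1, (hG.fst_ne hba).symm, ?_⟩
    rw [← quadrantUnion_eq_coordPlane, ← hc]
    convert SupNormIsotopic.refl _ using 1
    refine quadrantUnion_congr fun p q => ?_
    have := hall p q
    have := G.adj_comm p q
    simp only [mem_ofPred_eq, mem_insert_iff, mem_singleton_iff, Prod.mk.injEq] at *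
    grind
  · have hadj := hred a b c hac hb
    have hab := hba.symm
    have hcb := hbc.symm
    have hadj' := hadj.symm
    obtain ⟨d, hd, hda⟩ := hG.exists_other hba.symm
    obtain ⟨e, he, hec⟩ := hG.exists_other hbc.symm
    have hdc : d = c := by have := (hda c).mp hadj; have := hbc.ne; grind
    have hea : e = a := by have := (hec a).mp hadj'; have := hba.ne; grind
    subst hdc hea
    have hall := hcl (S := {e, b, d}) (by simp) (by
      intro p q hp hpq
      simp only [mem_insert_iff, mem_singleton_iff] at hp ⊢
      grind)
    refine ⟨e.1, b.1, (hG.fst_ne hba).symm, ?_⟩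
    convert supNormIsotopic_octant_boundary (hG.fst_ne hab) (hG.fst_ne hbc) hac using 1
    refine quadrantUnion_congr fun p q => ?_
    have := hall p q
    have := G.adj_comm p q
    have := hba.ne
    have := hbc.ne
    simp only [mem_ofPred_eq, mem_insert_iff, mem_singleton_iff, Prod.mk.injEq] at *
    grind

/-- Induction on the number of directions that carry an edge: a shortcut makes `b` isolated and adds
no new direction. -/
theorem IsDirectionCycle.supNormIsotopic {G : SimpleGraph (Fin 4 × Bool)}
    (hG : IsDirectionCycle G) : ∃ i j, i ≠ j ∧
      SupNormIsotopic (quadrantUnion {e | G.Adj e.1 e.2}) (coordPlane i j) := by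
  induction hn : {p | ∃ q, G.Adj p q}.ncard using Nat.strong_induction_on generalizing G with
  | _ n ih =>
  subst hn
  by_cases hred : ∃ a b c, a.1 ≠ c.1 ∧ (∀ s, G.Adj b s ↔ s = a ∨ s = c) ∧ ¬ G.Adj a c
  · obtain ⟨a, b, c, hac, hb, hnadj⟩ := hred
    have hba : G.Adj b a := (hb a).mpr (Or.inl rfl)
    have hbc : G.Adj b c := (hb c).mpr (Or.inr rfl)
    obtain ⟨i, j, hij, h⟩ := ih _ (Set.ncard_lt_ncard (by
      refine ⟨?_, fun h => ?_⟩
      · rintro p ⟨q, h | ⟨rfl, rfl⟩ | ⟨rfl, rfl⟩⟩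
        exacts [⟨q, h.1⟩, ⟨b, hba.symm⟩, ⟨b, hbc.symm⟩]
      · obtain ⟨q, h | ⟨rfl, rfl⟩ | ⟨rfl, rfl⟩⟩ := h (show b ∈ _ from ⟨a, hba⟩)
        exacts [h.2.1 rfl, hba.ne rfl, hbc.ne rfl]) (Set.toFinite _))
      (hG.shortcutGraph hac hb hnadj) rfl
    exact ⟨i, j, hij, (supNormIsotopic_shortcutGraph hG.fst_ne hac hb hnadj).trans h⟩
  · push Not at hred
    exact hG.supNormIsotopic_of_irreducible hred

/-! ### Surfaces and invariance of domain -/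

section Surface

variable {M : Type*} [TopologicalSpace M] [ChartedSpace (EuclideanSpace ℝ (Fin 2)) M]

/-- A small ball in the target of a chart is itself homeomorphic to the plane, so parametrizations
can be taken with the whole plane as domain. -/
theorem exists_isOpenEmbedding_euclideanPlane (x : M) {W : Set M} (hW : W ∈ 𝓝 x) :
    ∃ w : EuclideanSpace ℝ (Fin 2) → M, IsOpenEmbedding w ∧ w 0 = x ∧ range w ⊆ W := by
  let φ := chartAt (EuclideanSpace ℝ (Fin 2)) x
  have hx : x ∈ φ.source := mem_chart_source _ x
  have hpre : φ.symm ⁻¹' W ∈ 𝓝 (φ x) := by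
    refine (φ.continuousAt_symm (φ.map_source hx)).preimage_mem_nhds ?_
    rwa [φ.left_inv hx]
  obtain ⟨r, hr, hrs⟩ := Metric.mem_nhds_iff.mp
    (Filter.inter_mem hpre (φ.open_target.mem_nhds (φ.map_source hx)))
  let b := OpenPartialHomeomorph.univBall (φ x) r
  have hbt : b.target = ball (φ x) r := OpenPartialHomeomorph.univBall_target _ hr
  have hbs : b.source = univ := OpenPartialHomeomorph.univBall_source _ _
  have hmem : ∀ u, b u ∈ ball (φ x) r := fun u => by
    rw [← hbt]; exact b.map_source (by rw [hbs]; trivial)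
  have hsrc : (b.trans φ.symm).source = univ := by
    ext u
    simp only [OpenPartialHomeomorph.trans_source, hbs, mem_inter_iff, mem_univ, true_and, iff_true]
    exact (hrs (hmem u)).2
  refine ⟨b.trans φ.symm, (b.trans φ.symm).isOpenEmbedding hsrc, ?_, ?_⟩
  · change φ.symm (b 0) = x
    rw [OpenPartialHomeomorph.univBall_apply_zero, φ.left_inv hx]
  · rintro _ ⟨u, rfl⟩
    exact (hrs (hmem u)).1

theorem isOpen_image_of_injOn_surface {f : EuclideanSpace ℝ (Fin 2) → M}
    {U : Set (EuclideanSpace ℝ (Fin 2))} (hU : IsOpen U) (hc : ContinuousOn f U)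
    (hi : InjOn f U) : IsOpen (f '' U) := by
  rw [isOpen_iff_mem_nhds]
  rintro _ ⟨u, hu, rfl⟩
  obtain ⟨w, hw, hw0, -⟩ := exists_isOpenEmbedding_euclideanPlane (f u) Filter.univ_mem
  let e := hw.toOpenPartialHomeomorph
  have het : e.target = range w := hw.toOpenPartialHomeomorph_target
  have hU' : IsOpen (U ∩ f ⁻¹' range w) := hc.isOpen_inter_preimage hU hw.isOpen_range
  have hmaps : MapsTo f (U ∩ f ⁻¹' range w) e.target := fun v hv => by rw [het]; exact hv.2
  have hV := isOpen_image_of_injOn_euclideanPlane (f := e.symm ∘ f) hU'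
    (e.continuousOn_symm.comp (hc.mono inter_subset_left) hmaps)
    (e.symm.injOn.comp (hi.mono inter_subset_left) hmaps)
  refine Filter.mem_of_superset ((hw.isOpenMap _ hV).mem_nhds ⟨_, ⟨u, ⟨hu, 0, hw0⟩, rfl⟩, ?_⟩) ?_
  · exact e.right_inv (hmaps ⟨hu, 0, hw0⟩)
  · rintro _ ⟨_, ⟨v, hv, rfl⟩, rfl⟩
    refine ⟨v, hv.1, ?_⟩
    exact (e.right_inv (hmaps hv)).symm

end Surface

theorem image_mem_nhdsWithin_of_injOn_surface {X : Type*} [TopologicalSpace X] {N : Set X}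
    [ChartedSpace (EuclideanSpace ℝ (Fin 2)) N] {f : EuclideanSpace ℝ (Fin 2) → X}
    {U : Set (EuclideanSpace ℝ (Fin 2))} (hU : IsOpen U) (hc : ContinuousOn f U)
    (hi : InjOn f U) (hm : MapsTo f U N) {u : EuclideanSpace ℝ (Fin 2)} (hu : u ∈ U) :
    f '' U ∈ 𝓝[N] (f u) := by
  classical
  -- The value outside `U` is arbitrary; only the restriction to `U` matters.
  let f' : EuclideanSpace ℝ (Fin 2) → N := fun v => if h : v ∈ U then ⟨f v, hm h⟩ else ⟨f u, hm hu⟩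
  have hf' : ∀ v ∈ U, (f' v : X) = f v := fun v hv => by simp [f', hv]
  have hc' : ContinuousOn f' U := by
    rw [IsInducing.subtypeVal.continuousOn_iff]
    exact hc.congr hf'
  have hi' : InjOn f' U := fun v hv v' hv' h => hi hv hv' (by rw [← hf' v hv, ← hf' v' hv', h])
  have := (isOpen_image_of_injOn_surface hU hc' hi').mem_nhds ⟨u, hu, rfl⟩
  rw [mem_nhds_subtype_iff_nhdsWithin, hf' u hu] at this
  refine Filter.mem_of_superset this ?_
  rintro _ ⟨_, ⟨v, hv, rfl⟩, rfl⟩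
  exact ⟨v, hv, (hf' v hv).symm⟩

/-! ### A gridded surface near the origin -/

/-- The coordinates of a point with respect to the signed unit vectors `p` and `q`. -/
noncomputable def pairCoord (p q : Fin 4 × Bool) (x : EuclideanSpace ℝ (Fin 4)) :
    EuclideanSpace ℝ (Fin 2) := !₂[signedCoord p x, signedCoord q x]

theorem continuous_pairCoord (p q : Fin 4 × Bool) : Continuous (pairCoord p q) := by
  have := continuous_signedCoord p
  have := continuous_signedCoord q
  unfold pairCoord
  refine (PiLp.continuous_toLp 2 _).comp (continuous_pi fun i => ?_)
  fin_cases i <;> simpa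

theorem eq_of_signedCoord_eq {p q : Fin 4 × Bool} {x y : EuclideanSpace ℝ (Fin 4)}
    (hx : ∀ k, k ≠ p.1 → k ≠ q.1 → x k = 0) (hy : ∀ k, k ≠ p.1 → k ≠ q.1 → y k = 0)
    (hp : signedCoord p x = signedCoord p y) (hq : signedCoord q x = signedCoord q y) : x = y := by
  have key : ∀ s : Fin 4 × Bool, signedCoord s x = signedCoord s y → x s.1 = y s.1 := fun s h => by
    unfold signedCoord at h; split_ifs at h <;> linarith
  ext k
  by_cases h1 : k = p.1
  · rw [h1]; exact key p hp
  by_cases h2 : k = q.1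
  · rw [h2]; exact key q hq
  rw [hx k h1 h2, hy k h1 h2]

/-- A nonzero coordinate of absolute value less than `1` is not an integer, so it must be an edge
direction of the face containing `x`, and there are at most two of these. -/
theorem apply_eq_zero_of_mem_cubSkeleton {x : EuclideanSpace ℝ (Fin 4)} (hx : x ∈ cubSkeleton 4 2)
    (h1 : supNorm x < 1) {i j k : Fin 4} (hij : i ≠ j) (hki : k ≠ i) (hkj : k ≠ j) (hi : x i ≠ 0)
    (hj : x j ≠ 0) : x k = 0 := by
  obtain ⟨_, ⟨n, hn, v, s, hs, rfl⟩, hxs⟩ := hx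
  rw [supNorm_lt_iff one_pos] at h1
  have key : ∀ i, x i ≠ 0 → i ∈ s := fun i hi => by
    by_contra his
    have h2 := hxs i
    simp only [his, if_false, add_zero] at h2
    have h3 : x i = (v i : ℝ) := le_antisymm h2.2 h2.1
    have h4 : |(v i : ℝ)| < 1 := by rw [← h3]; exact h1 i
    have h5 : v i = 0 := Int.abs_lt_one_iff.mp (by exact_mod_cast h4)
    rw [h3, h5, Int.cast_zero] at hi
    exact hi rfl
  by_contra hk
  have hsub : ({i, j, k} : Finset (Fin 4)) ⊆ s := by
    intro a ha
    simp only [Finset.mem_insert, Finset.mem_singleton] at ha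
    rcases ha with rfl | rfl | rfl
    exacts [key _ hi, key _ hj, key _ hk]
  have := Finset.card_le_card hsub
  rw [Finset.card_eq_three.mpr ⟨i, j, k, hij, hki.symm, hkj.symm, rfl⟩] at this
  omega

theorem exists_signedCoord_pos {x : EuclideanSpace ℝ (Fin 4)} {k : Fin 4} (hk : x k ≠ 0) :
    ∃ p : Fin 4 × Bool, p.1 = k ∧ 0 < signedCoord p x := by
  rcases lt_or_gt_of_ne hk with h | h
  · exact ⟨(k, false), rfl, by simpa [signedCoord] using h⟩
  · exact ⟨(k, true), rfl, by simpa [signedCoord] using h⟩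

/-- The closed unit square spanned by the signed unit vectors `p` and `q`. -/
def unitQuad (p q : Fin 4 × Bool) : Set (EuclideanSpace ℝ (Fin 4)) :=
  quadrant p q ∩ {x | supNorm x ≤ 1}

/-- The point with coordinates `s` and `t` with respect to the signed unit vectors `p` and `q`. -/
noncomputable def pairPoint (p q : Fin 4 × Bool) (s t : ℝ) : EuclideanSpace ℝ (Fin 4) :=
  s • signedUnit p + t • signedUnit q

theorem continuous_pairPoint {Y : Type*} [TopologicalSpace Y] (p q : Fin 4 × Bool) {s t : Y → ℝ}
    (hs : Continuous s) (ht : Continuous t) : Continuous fun y => pairPoint p q (s y) (t y) := by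
  unfold pairPoint; fun_prop

theorem signedCoord_pairPoint_left {p q : Fin 4 × Bool} (h : p.1 ≠ q.1) (s t : ℝ) :
    signedCoord p (pairPoint p q s t) = s := by
  simp [pairPoint, signedCoord_signedUnit_of_ne h]

theorem signedCoord_pairPoint_right {p q : Fin 4 × Bool} (h : p.1 ≠ q.1) (s t : ℝ) :
    signedCoord q (pairPoint p q s t) = t := by
  simp [pairPoint, signedCoord_signedUnit_of_ne h.symm]

theorem pairPoint_apply_of_ne {p q : Fin 4 × Bool} (s t : ℝ) {k : Fin 4} (hp : k ≠ p.1)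
    (hq : k ≠ q.1) : pairPoint p q s t k = 0 := by
  simp [pairPoint, apply_signedUnit_of_ne hp, apply_signedUnit_of_ne hq]

theorem pairPoint_signedCoord {p q : Fin 4 × Bool} (h : p.1 ≠ q.1) {x : EuclideanSpace ℝ (Fin 4)}
    (hx : ∀ k, k ≠ p.1 → k ≠ q.1 → x k = 0) :
    pairPoint p q (signedCoord p x) (signedCoord q x) = x :=
  eq_of_signedCoord_eq (fun _ h1 h2 => pairPoint_apply_of_ne _ _ h1 h2) hx
    (signedCoord_pairPoint_left h _ _) (signedCoord_pairPoint_right h _ _)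

theorem pairPoint_mem_quadrant {p q : Fin 4 × Bool} (h : p.1 ≠ q.1) {s t : ℝ} (hs : 0 ≤ s)
    (ht : 0 ≤ t) : pairPoint p q s t ∈ quadrant p q :=
  ⟨by rwa [signedCoord_pairPoint_left h], by rwa [signedCoord_pairPoint_right h],
    fun _ h1 h2 => pairPoint_apply_of_ne _ _ h1 h2⟩

theorem supNorm_pairPoint {p q : Fin 4 × Bool} (h : p.1 ≠ q.1) (s t : ℝ) :
    supNorm (pairPoint p q s t) = max |s| |t| := by
  have hp := abs_signedCoord p (pairPoint p q s t)
  have hq := abs_signedCoord q (pairPoint p q s t)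
  rw [signedCoord_pairPoint_left h] at hp
  rw [signedCoord_pairPoint_right h] at hq
  refine le_antisymm ((supNorm_le_iff (by positivity)).mpr fun k => ?_) (max_le ?_ ?_)
  · by_cases h1 : k = p.1
    · rw [h1, ← hp]; exact le_max_left _ _
    by_cases h2 : k = q.1
    · rw [h2, ← hq]; exact le_max_right _ _
    rw [pairPoint_apply_of_ne _ _ h1 h2, abs_zero]; positivity
  · rw [hp]; exact (supNorm_le_iff (supNorm_nonneg _)).mp le_rfl _
  · rw [hq]; exact (supNorm_le_iff (supNorm_nonneg _)).mp le_rfl _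

theorem pairPoint_mem_unitQuad {p q : Fin 4 × Bool} (h : p.1 ≠ q.1) {s t : ℝ} (hs : 0 ≤ s)
    (ht : 0 ≤ t) (hs1 : s ≤ 1) (ht1 : t ≤ 1) : pairPoint p q s t ∈ unitQuad p q := by
  refine ⟨pairPoint_mem_quadrant h hs ht, ?_⟩
  rw [mem_ofPred_eq, supNorm_pairPoint h, abs_of_nonneg hs, abs_of_nonneg ht]
  exact max_le hs1 ht1

/-- A surface that is a closed subset contains a unit square as soon as it meets its interior. -/
theorem unitQuad_subset_of_mem {N : Set (EuclideanSpace ℝ (Fin 4))} (hN : IsGriddedSurface N)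
    (hcl : IsClosed N) {p q : Fin 4 × Bool} (hpq : p.1 ≠ q.1) {x : EuclideanSpace ℝ (Fin 4)}
    (hx : x ∈ N) (hx1 : supNorm x < 1) (hp : 0 < signedCoord p x) (hq : 0 < signedCoord q x) :
    unitQuad p q ⊆ N := by
  obtain ⟨_⟩ := hN.manifold
  have hne : ∀ {r : Fin 4 × Bool} {z : EuclideanSpace ℝ (Fin 4)}, 0 < signedCoord r z → z r.1 ≠ 0 :=
    fun h h' => h.ne' (signedCoord_eq_zero_iff.mpr h')
  have hzero : ∀ z ∈ N, supNorm z < 1 → 0 < signedCoord p z → 0 < signedCoord q z →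
      ∀ k, k ≠ p.1 → k ≠ q.1 → z k = 0 := fun z hz h1 h2 h3 k hk hk' =>
    apply_eq_zero_of_mem_cubSkeleton (hN.subset_skeleton hz) h1 hpq hk hk' (hne h2) (hne h3)
  let R : Set (EuclideanSpace ℝ (Fin 2)) := {u | ∀ i, u i ∈ Ioo (0 : ℝ) 1}
  have hRo : IsOpen R := by
    simp only [R, Set.ofPred_forall]
    exact isOpen_iInter_of_finite fun i => isOpen_Ioo.preimage (by fun_prop)
  have hRc : IsPreconnected R := by
    refine Convex.isPreconnected fun u hu v hv a b ha hb hab i => ?_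
    exact convex_Ioo (0 : ℝ) 1 (hu i) (hv i) ha hb hab
  let sq : EuclideanSpace ℝ (Fin 2) → EuclideanSpace ℝ (Fin 4) := fun u => pairPoint p q (u 0) (u 1)
  have hsq : Continuous sq := continuous_pairPoint p q (by fun_prop) (by fun_prop)
  have hpc : ∀ z, pairCoord p q z 0 = signedCoord p z ∧ pairCoord p q z 1 = signedCoord q z :=
    fun z => by simp [pairCoord]
  -- Near such a point `N` lies in the plane of `p` and `q`, so the two coordinates are injective on
  -- a parametrization and their image is open.
  have hopen : IsOpen (R ∩ sq ⁻¹' N) := by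
    rw [isOpen_iff_mem_nhds]
    rintro u ⟨huR, huN⟩
    let W : Set (EuclideanSpace ℝ (Fin 4)) :=
      {z | supNorm z < 1 ∧ 0 < signedCoord p z ∧ 0 < signedCoord q z}
    have hW : IsOpen W := (isOpen_lt continuous_supNorm continuous_const).inter
      ((isOpen_lt continuous_const (continuous_signedCoord p)).inter
        (isOpen_lt continuous_const (continuous_signedCoord q)))
    have huW : sq u ∈ W := by
      refine ⟨?_, ?_, ?_⟩
      · rw [supNorm_pairPoint hpq, abs_of_pos (huR 0).1, abs_of_pos (huR 1).1]
        exact max_lt (huR 0).2 (huR 1).2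
      · rw [signedCoord_pairPoint_left hpq]; exact (huR 0).1
      · rw [signedCoord_pairPoint_right hpq]; exact (huR 1).1
    obtain ⟨w, hw, hw0, hwW⟩ := exists_isOpenEmbedding_euclideanPlane (⟨sq u, huN⟩ : N)
      ((hW.preimage continuous_subtype_val).mem_nhds huW)
    have hV := isOpen_image_of_injOn_euclideanPlane (f := fun v => pairCoord p q (w v)) isOpen_univ
      ((continuous_pairCoord p q).comp (continuous_subtype_val.comp hw.continuous)).continuousOn (by
        intro v _ v' _ h
        have h1 := hwW ⟨v, rfl⟩
        have h2 := hwW ⟨v', rfl⟩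
        refine hw.injective (Subtype.ext (eq_of_signedCoord_eq
          (hzero _ (w v).2 h1.1 h1.2.1 h1.2.2) (hzero _ (w v').2 h2.1 h2.2.1 h2.2.2) ?_ ?_))
        · rw [← (hpc _).1, ← (hpc _).1]; exact congr($h 0)
        · rw [← (hpc _).2, ← (hpc _).2]; exact congr($h 1))
    refine Filter.mem_of_superset (hV.mem_nhds ⟨0, trivial, ?_⟩) ?_
    · ext i
      simp only [hw0]
      fin_cases i
      · exact (hpc _).1.trans (signedCoord_pairPoint_left hpq _ _)
      · exact (hpc _).2.trans (signedCoord_pairPoint_right hpq _ _)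
    · rintro _ ⟨v, -, rfl⟩
      have h1 := hwW ⟨v, rfl⟩
      have hlt : ∀ r : Fin 4 × Bool, signedCoord r (w v) < 1 := fun r =>
        (le_abs_self _).trans_lt (by
          rw [abs_signedCoord]; exact (supNorm_lt_iff one_pos).mp h1.1 _)
      refine ⟨fun i => ?_, ?_⟩
      · fin_cases i
        · simp only [Fin.zero_eta, (hpc _).1]; exact ⟨h1.2.1, hlt p⟩
        · simp only [Fin.mk_one, (hpc _).2]; exact ⟨h1.2.2, hlt q⟩
      · change pairPoint p q _ _ ∈ N
        rw [(hpc _).1, (hpc _).2,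
          pairPoint_signedCoord hpq (hzero _ (w v).2 h1.1 h1.2.1 h1.2.2)]
        exact (w v).2
  -- The part in `N` is open and relatively closed in the connected open square, and contains the
  -- coordinates of `x`.
  have hsub : R ⊆ R ∩ sq ⁻¹' N := by
    refine hRc.subset_of_closure_inter_subset hopen ?_ ?_
    · have hlt : ∀ r : Fin 4 × Bool, signedCoord r x < 1 := fun r =>
        (le_abs_self _).trans_lt (by
          rw [abs_signedCoord]; exact (supNorm_lt_iff one_pos).mp hx1 _)
      have hxR : pairCoord p q x ∈ R := fun i => by
        fin_cases i
        · simp only [Fin.zero_eta, (hpc _).1]; exact ⟨hp, hlt p⟩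
        · simp only [Fin.mk_one, (hpc _).2]; exact ⟨hq, hlt q⟩
      refine ⟨pairCoord p q x, hxR, hxR, ?_⟩
      change pairPoint p q _ _ ∈ N
      rwa [(hpc _).1, (hpc _).2, pairPoint_signedCoord hpq (hzero _ hx hx1 hp hq)]
    · rintro u ⟨hu, huR⟩
      have := closure_mono (inter_subset_right : R ∩ sq ⁻¹' N ⊆ _) hu
      rw [(hcl.preimage hsq).closure_eq] at this
      exact ⟨huR, this⟩
  rintro z ⟨hz, hz1⟩
  have hle : ∀ r : Fin 4 × Bool, signedCoord r z ≤ 1 := fun r =>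
    (le_abs_self _).trans (by
      rw [abs_signedCoord]; exact (supNorm_le_iff zero_le_one).mp hz1 _)
  -- Points of the closed square are limits of interior points, on the segment towards the centre
  -- `(1/2, 1/2)`.
  have hcont : Continuous fun ε : ℝ => pairPoint p q
      (signedCoord p z + ε * (1 / 2 - signedCoord p z))
      (signedCoord q z + ε * (1 / 2 - signedCoord q z)) :=
    continuous_pairPoint p q (by fun_prop) (by fun_prop)
  have hlim := (hcont.tendsto 0).mono_left (nhdsWithin_le_nhds (s := Ioi 0))
  simp only [zero_mul, add_zero, pairPoint_signedCoord hpq hz.2.2] at hlim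
  refine hcl.mem_of_tendsto hlim ?_
  filter_upwards [Ioo_mem_nhdsGT (zero_lt_one (α := ℝ))] with ε hε
  have hin : ∀ a : ℝ, 0 ≤ a → a ≤ 1 → a + ε * (1 / 2 - a) ∈ Ioo (0 : ℝ) 1 := fun a h0 h1 => by
    obtain ⟨h2, h3⟩ := hε
    constructor <;> nlinarith
  have h := hsub (a := !₂[signedCoord p z + ε * (1 / 2 - signedCoord p z),
    signedCoord q z + ε * (1 / 2 - signedCoord q z)]) (fun i => by
      fin_cases i
      · exact hin _ hz.1 (hle p)
      · exact hin _ hz.2.1 (hle q))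
  exact h.2

/-- The directions in which a surface `N` leaves the origin, two of them being adjacent when they
span a unit square of `N`. -/
def starGraph (N : Set (EuclideanSpace ℝ (Fin 4))) : SimpleGraph (Fin 4 × Bool) where
  Adj p q := p.1 ≠ q.1 ∧ unitQuad p q ⊆ N
  symm := ⟨fun p q h => ⟨h.1.symm, by rw [unitQuad, quadrant_comm]; exact h.2⟩⟩
  loopless := ⟨fun _ h => h.1 rfl⟩

section

variable {N : Set (EuclideanSpace ℝ (Fin 4))}

theorem exists_adj_starGraph_of_signedCoord_pos (hN : IsGriddedSurface N) (hcl : IsClosed N)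
    {x : EuclideanSpace ℝ (Fin 4)} (hx : x ∈ N) (hx1 : supNorm x < 1) {p : Fin 4 × Bool}
    (hp : 0 < signedCoord p x) :
    (∀ k, k ≠ p.1 → x k = 0) ∨ ∃ q, (starGraph N).Adj p q ∧ x ∈ quadrant p q := by
  by_cases h : ∀ k, k ≠ p.1 → x k = 0
  · exact Or.inl h
  push Not at h
  obtain ⟨k, hk, hxk⟩ := h
  obtain ⟨q, rfl, hq⟩ := exists_signedCoord_pos hxk
  have hp0 : x p.1 ≠ 0 := fun h => hp.ne' (signedCoord_eq_zero_iff.mpr h)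
  exact Or.inr ⟨q, ⟨hk.symm, unitQuad_subset_of_mem hN hcl hk.symm hx hx1 hp hq⟩, hp.le, hq.le,
    fun j h1 h2 => apply_eq_zero_of_mem_cubSkeleton (hN.subset_skeleton hx) hx1 hk.symm h1 h2
      hp0 hxk⟩

/-- A surface is not contained in a half-plane near a point of the boundary line. -/
theorem exists_adj_starGraph_ne (hN : IsGriddedSurface N) (hcl : IsClosed N)
    {x : EuclideanSpace ℝ (Fin 4)} (hx : x ∈ N) (hx1 : supNorm x < 1) {p q : Fin 4 × Bool}
    (hp : 0 < signedCoord p x) (hxk : ∀ k, k ≠ p.1 → x k = 0) (hpq : p.1 ≠ q.1) :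
    ∃ r, (starGraph N).Adj p r ∧ r ≠ q := by
  by_contra! hall
  obtain ⟨_⟩ := hN.manifold
  let W : Set (EuclideanSpace ℝ (Fin 4)) := {z | supNorm z < 1 ∧ 0 < signedCoord p z}
  have hW : IsOpen W := (isOpen_lt continuous_supNorm continuous_const).inter
    (isOpen_lt continuous_const (continuous_signedCoord p))
  -- If `q` is the only possible neighbour of `p`, then `N` lies near `x` in the single quadrant
  -- `(p, q)`.
  have hquad : ∀ z ∈ N, z ∈ W → z ∈ quadrant p q := by
    rintro z hz ⟨h1, h2⟩
    rcases exists_adj_starGraph_of_signedCoord_pos hN hcl hz h1 h2 with h | ⟨r, hr, hzr⟩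
    · exact ⟨h2.le, (signedCoord_eq_zero_iff.mpr (h _ hpq.symm)).ge, fun k hk _ => h k hk⟩
    · rwa [hall r hr] at hzr
  obtain ⟨w, hw, hw0, hwW⟩ := exists_isOpenEmbedding_euclideanPlane (⟨x, hx⟩ : N)
    ((hW.preimage continuous_subtype_val).mem_nhds ⟨hx1, hp⟩)
  have hwq : ∀ v, (w v : EuclideanSpace ℝ (Fin 4)) ∈ quadrant p q := fun v =>
    hquad _ (w v).2 (hwW ⟨v, rfl⟩)
  have hpc : ∀ z, pairCoord p q z 0 = signedCoord p z ∧ pairCoord p q z 1 = signedCoord q z :=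
    fun z => by simp [pairCoord]
  have hV := isOpen_image_of_injOn_euclideanPlane (f := fun v => pairCoord p q (w v)) isOpen_univ
    ((continuous_pairCoord p q).comp (continuous_subtype_val.comp hw.continuous)).continuousOn (by
      intro v _ v' _ h
      refine hw.injective (Subtype.ext (eq_of_signedCoord_eq (hwq v).2.2 (hwq v').2.2 ?_ ?_))
      · rw [← (hpc _).1, ← (hpc _).1]; exact congr($h 0)
      · rw [← (hpc _).2, ← (hpc _).2]; exact congr($h 1))
  have hcont : Continuous fun ε : ℝ => (!₂[signedCoord p x, -ε] : EuclideanSpace ℝ (Fin 2)) := by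
    refine (PiLp.continuous_toLp 2 _).comp (continuous_pi fun i => ?_)
    fin_cases i
    · exact continuous_const
    · exact continuous_neg
  have hlim := (hcont.tendsto 0).mono_left (nhdsWithin_le_nhds (s := Ioi 0))
  have hxV : (!₂[signedCoord p x, -0] : EuclideanSpace ℝ (Fin 2)) ∈
      (fun v => pairCoord p q (w v)) '' univ := by
    refine ⟨0, trivial, ?_⟩
    simp [hw0, pairCoord, signedCoord_eq_zero_iff.mpr (hxk _ hpq.symm)]
  -- The open coordinate image would contain points with slightly negative `q`-coordinate.
  obtain ⟨ε, ⟨v, -, hv⟩, hε⟩ := ((hlim.eventually (hV.mem_nhds hxV)).and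
    self_mem_nhdsWithin).exists
  have h1 : signedCoord q (w v) = -ε := by
    rw [← (hpc _).2]; exact congr($hv 1)
  have h2 := (hwq v).2.1
  rw [h1] at h2
  exact absurd hε (not_lt.mpr (by linarith))

/-- A surface does not contain three half-planes with the same boundary line. -/
theorem eq_or_eq_of_adj_starGraph (hN : IsGriddedSurface N) {p q₁ q₂ q₃ : Fin 4 × Bool}
    (h₁ : (starGraph N).Adj p q₁) (h₂ : (starGraph N).Adj p q₂) (h₃ : (starGraph N).Adj p q₃)
    (h12 : q₁ ≠ q₂) : q₃ = q₁ ∨ q₃ = q₂ := by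
  by_contra! h
  obtain ⟨_⟩ := hN.manifold
  -- The plane folded along the `p`-axis: the upper half goes to the square of `q₁`, the lower half
  -- to that of `q₂`. By invariance of domain its image is a neighbourhood in `N` of each point of
  -- the crease.
  let f : EuclideanSpace ℝ (Fin 2) → EuclideanSpace ℝ (Fin 4) := fun u =>
    if 0 ≤ u 1 then pairPoint p q₁ (u 0) (u 1) else pairPoint p q₂ (u 0) (-u 1)
  have hf1 : ∀ u, 0 ≤ u 1 → f u = pairPoint p q₁ (u 0) (u 1) := fun u hu => if_pos hu
  have hf2 : ∀ u, u 1 ≤ 0 → f u = pairPoint p q₂ (u 0) (-u 1) := fun u hu => by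
    rcases hu.lt_or_eq with hu | hu
    · exact if_neg (not_le.mpr hu)
    · rw [hf1 u hu.ge, hu]; simp [pairPoint]
  have hfc : Continuous f := by
    refine Continuous.if_le (continuous_pairPoint _ _ (by fun_prop) (by fun_prop))
      (continuous_pairPoint _ _ (by fun_prop) (by fun_prop)) continuous_const (by fun_prop) ?_
    intro u hu
    rw [← hu]; simp [pairPoint]
  let U : Set (EuclideanSpace ℝ (Fin 2)) := {u | u 0 ∈ Ioo (0 : ℝ) 1 ∧ u 1 ∈ Ioo (-1 : ℝ) 1}
  have hU : IsOpen U := (isOpen_Ioo.preimage (by fun_prop)).inter (isOpen_Ioo.preimage (by fun_prop))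
  have hfp : ∀ u, signedCoord p (f u) = u 0 := fun u => by
    rcases le_total 0 (u 1) with hu | hu
    · rw [hf1 u hu, signedCoord_pairPoint_left h₁.1]
    · rw [hf2 u hu, signedCoord_pairPoint_left h₂.1]
  have hext : ∀ u v : EuclideanSpace ℝ (Fin 2), u 0 = v 0 → u 1 = v 1 → u = v := fun u v h0 h1 => by
    ext i; fin_cases i
    exacts [h0, h1]
  -- The `q₁`-coordinate is nonpositive on the second quadrant and the `q₂`-coordinate on the first,
  -- so the two halves can meet only along the crease.
  have hpos : ∀ u ∈ U, ∀ v ∈ U, 0 ≤ u 1 → v 1 ≤ 0 → f u = f v → u 1 = v 1 := by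
    intro u hu v hv hu1 hv1 he
    have huq : f u ∈ quadrant p q₁ := by
      rw [hf1 u hu1]; exact pairPoint_mem_quadrant h₁.1 hu.1.1.le hu1
    have hvq : f v ∈ quadrant p q₂ := by
      rw [hf2 v hv1]; exact pairPoint_mem_quadrant h₂.1 hv.1.1.le (by linarith)
    have e1 : signedCoord q₁ (f u) = u 1 := by rw [hf1 u hu1, signedCoord_pairPoint_right h₁.1]
    have e2 : signedCoord q₂ (f v) = -v 1 := by rw [hf2 v hv1, signedCoord_pairPoint_right h₂.1]
    have hne : ∀ {q : Fin 4 × Bool}, p.1 ≠ q.1 → q ≠ p := fun h h' => h (by rw [h'])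
    have i1 := signedCoord_nonpos_of_mem_quadrant (hne h₁.1) h12 hvq
    have i2 := signedCoord_nonpos_of_mem_quadrant (hne h₂.1) h12.symm huq
    rw [← he] at e2 i1
    linarith
  have hinj : InjOn f U := by
    intro u hu v hv he
    refine hext u v (by rw [← hfp u, ← hfp v, he]) ?_
    rcases le_total 0 (u 1) with hu1 | hu1 <;> rcases le_total 0 (v 1) with hv1 | hv1
    · have := congrArg (signedCoord q₁) he
      rwa [hf1 u hu1, hf1 v hv1, signedCoord_pairPoint_right h₁.1,
        signedCoord_pairPoint_right h₁.1] at this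
    · exact hpos u hu v hv hu1 hv1 he
    · exact (hpos v hv u hu hv1 hu1 he.symm).symm
    · have := congrArg (signedCoord q₂) he
      rw [hf2 u hu1, hf2 v hv1, signedCoord_pairPoint_right h₂.1,
        signedCoord_pairPoint_right h₂.1] at this
      linarith
  have hmaps : MapsTo f U N := by
    intro u hu
    rcases le_total 0 (u 1) with hu1 | hu1
    · rw [hf1 u hu1]
      exact h₁.2 (pairPoint_mem_unitQuad h₁.1 hu.1.1.le hu1 hu.1.2.le hu.2.2.le)
    · rw [hf2 u hu1]
      exact h₂.2 (pairPoint_mem_unitQuad h₂.1 hu.1.1.le (by linarith) hu.1.2.le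
        (by linarith [hu.2.1]))
  have hu0 : (!₂[1 / 2, 0] : EuclideanSpace ℝ (Fin 2)) ∈ U := by
    constructor <;> norm_num
  have hnhds := image_mem_nhdsWithin_of_injOn_surface hU hfc.continuousOn hinj hmaps hu0
  have hfu0 : f !₂[1 / 2, 0] = pairPoint p q₃ (1 / 2) 0 := by
    rw [hf1 _ (by simp)]; simp [pairPoint]
  rw [hfu0] at hnhds
  have hcont : Continuous fun ε : ℝ => pairPoint p q₃ (1 / 2) ε :=
    continuous_pairPoint p q₃ continuous_const continuous_id
  -- Points of the third square approach the crease within `N`, but have positive `q₃`-coordinate,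
  -- which is nonpositive on the image of `f`.
  have hlim : Filter.Tendsto (fun ε : ℝ => pairPoint p q₃ (1 / 2) ε) (𝓝[>] 0)
      (𝓝[N] (pairPoint p q₃ (1 / 2) 0)) := by
    refine tendsto_nhdsWithin_iff.mpr
      ⟨(hcont.tendsto 0).mono_left (nhdsWithin_le_nhds (s := Ioi 0)), ?_⟩
    filter_upwards [Ioo_mem_nhdsGT (zero_lt_one (α := ℝ))] with ε hε
    exact h₃.2 (pairPoint_mem_unitQuad h₃.1 (by norm_num) hε.1.le (by norm_num) hε.2.le)
  obtain ⟨ε, ⟨u, hu, hue⟩, hε⟩ := ((hlim.eventually hnhds).and self_mem_nhdsWithin).exists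
  have hq3 : signedCoord q₃ (f u) = ε := by
    rw [hue, signedCoord_pairPoint_right h₃.1]
  have hq3p : q₃ ≠ p := fun h' => h₃.1 (by rw [h'])
  have hle : signedCoord q₃ (f u) ≤ 0 := by
    rcases le_total 0 (u 1) with hu1 | hu1
    · rw [hf1 u hu1]
      exact signedCoord_nonpos_of_mem_quadrant hq3p h.1
        (pairPoint_mem_quadrant h₁.1 hu.1.1.le hu1)
    · rw [hf2 u hu1]
      exact signedCoord_nonpos_of_mem_quadrant hq3p h.2
        (pairPoint_mem_quadrant h₂.1 hu.1.1.le (by linarith))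
  rw [hq3] at hle
  exact absurd hε (not_lt.mpr hle)

theorem exists_adj_starGraph_mem_quadrant (hN : IsGriddedSurface N) (hcl : IsClosed N)
    {x : EuclideanSpace ℝ (Fin 4)} (hx : x ∈ N) (hx1 : supNorm x < 1) (hx0 : x ≠ 0) :
    ∃ p q, (starGraph N).Adj p q ∧ x ∈ quadrant p q := by
  obtain ⟨k, hk⟩ : ∃ k, x k ≠ 0 := by
    by_contra! h
    exact hx0 (by ext k; exact h k)
  obtain ⟨p, rfl, hp⟩ := exists_signedCoord_pos hk
  rcases exists_adj_starGraph_of_signedCoord_pos hN hcl hx hx1 hp with h | ⟨q, hq, hxq⟩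
  -- On an axis any neighbour of `p` serves; the direction to be avoided is an arbitrary orthogonal
  -- one.
  · obtain ⟨k, hk⟩ := exists_ne p.1
    obtain ⟨r, hr, -⟩ := exists_adj_starGraph_ne hN hcl hx hx1 hp h (q := (k, true)) hk.symm
    exact ⟨p, r, hr, hp.le, (signedCoord_eq_zero_iff.mpr (h _ hr.1.symm)).ge,
      fun j hj _ => h j hj⟩
  · exact ⟨p, q, hq, hxq⟩

/-- The unit squares of a closed gridded surface at the origin form a single cycle. -/
theorem isDirectionCycle_starGraph (hN : IsGriddedSurface N) (hcl : IsClosed N)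
    (h0 : (0 : EuclideanSpace ℝ (Fin 4)) ∈ N) : IsDirectionCycle (starGraph N) := by
  obtain ⟨_⟩ := hN.manifold
  obtain ⟨w, hw, hw0, hwW⟩ := exists_isOpenEmbedding_euclideanPlane (⟨0, h0⟩ : N)
    (((isOpen_lt continuous_supNorm (continuous_const (y := (1 : ℝ)))).preimage
      continuous_subtype_val).mem_nhds (by simp))
  have hw0' : (w 0 : EuclideanSpace ℝ (Fin 4)) = 0 := by rw [hw0]
  have hwne : ∀ u, u ≠ 0 → (w u : EuclideanSpace ℝ (Fin 4)) ≠ 0 := fun u hu h =>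
    hu (hw.injective (Subtype.ext (h.trans hw0'.symm)))
  have hlt : ∀ u, supNorm (w u : EuclideanSpace ℝ (Fin 4)) < 1 := fun u => hwW ⟨u, rfl⟩
  refine ⟨fun h => h.1, ?_, ?_, ?_⟩
  · intro p q hpq
    have hmem : pairPoint p q (1 / 2) 0 ∈ N :=
      hpq.2 (pairPoint_mem_unitQuad hpq.1 (by norm_num) le_rfl (by norm_num) zero_le_one)
    obtain ⟨r, hr, hrq⟩ := exists_adj_starGraph_ne hN hcl hmem (p := p) (q := q)
      (by rw [supNorm_pairPoint hpq.1]; norm_num)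
      (by rw [signedCoord_pairPoint_left hpq.1]; norm_num)
      (fun k hk => by simp [pairPoint, apply_signedUnit_of_ne hk]) hpq.1
    refine ⟨r, hrq, fun s => ⟨fun hs => eq_or_eq_of_adj_starGraph hN hpq hr hs hrq.symm, ?_⟩⟩
    rintro (rfl | rfl)
    exacts [hpq, hr]
  · intro S hS p q r s hpq hrs hp
    by_contra hr
    have hpre : IsPreconnected ({0}ᶜ : Set (EuclideanSpace ℝ (Fin 2))) :=
      (isConnected_compl_singleton_of_one_lt_rank (by
        rw [← Module.finrank_eq_rank, finrank_euclideanSpace_fin]; norm_num) 0).isPreconnected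
    -- For `S` closed under adjacency, `O S` and `O Sᶜ` are open and cover the punctured plane. A
    -- common point would have a positive coordinate in `S` and one outside; both directions span a
    -- square of `N` or coincide, which is absurd.
    let O : Set (Fin 4 × Bool) → Set (EuclideanSpace ℝ (Fin 2)) := fun T =>
      {u | ∃ a ∈ T, 0 < signedCoord a (w u)}
    have hO : ∀ T, IsOpen (O T) := fun T => by
      have : O T = ⋃ a ∈ T, {u | 0 < signedCoord a (w u)} := by ext u; simp [O]
      rw [this]
      exact isOpen_biUnion fun a _ => isOpen_lt continuous_const
        ((continuous_signedCoord a).comp (continuous_subtype_val.comp hw.continuous))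
    -- Short vectors in direction `a` lie in `N`, hence in the image of the parametrization.
    have hne : ∀ T : Set (Fin 4 × Bool), ∀ {a b}, (starGraph N).Adj a b → a ∈ T →
        (({0}ᶜ : Set (EuclideanSpace ℝ (Fin 2))) ∩ O T).Nonempty := by
      intro T a b hab ha
      have hcont : Continuous fun ε : ℝ => pairPoint a b ε 0 :=
        continuous_pairPoint a b continuous_id continuous_const
      have hlim : Filter.Tendsto (fun ε : ℝ => pairPoint a b ε 0) (𝓝[>] 0) (𝓝[N] 0) := by
        refine tendsto_nhdsWithin_iff.mpr ⟨?_, ?_⟩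
        · have := (hcont.tendsto 0).mono_left (nhdsWithin_le_nhds (s := Ioi 0))
          simpa [pairPoint] using this
        · filter_upwards [Ioo_mem_nhdsGT (zero_lt_one (α := ℝ))] with ε hε
          exact hab.2 (pairPoint_mem_unitQuad hab.1 hε.1.le le_rfl hε.2.le zero_le_one)
      have hnhds : Subtype.val '' range w ∈ 𝓝[N] (0 : EuclideanSpace ℝ (Fin 4)) := by
        have := hw.isOpen_range.mem_nhds ⟨0, rfl⟩
        rwa [mem_nhds_subtype_iff_nhdsWithin, hw0'] at this
      obtain ⟨ε, ⟨_, ⟨u, rfl⟩, hu⟩, hε⟩ := ((hlim.eventually hnhds).and self_mem_nhdsWithin).exists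
      have hpos : 0 < signedCoord a (w u) := by
        rw [hu, signedCoord_pairPoint_left hab.1]; exact hε
      refine ⟨u, ?_, a, ha, hpos⟩
      rintro rfl
      rw [hw0', signedCoord_zero] at hpos
      exact lt_irrefl _ hpos
    obtain ⟨u, hu, ⟨a, ha, hau⟩, b, hb, hbu⟩ := hpre (O S) (O Sᶜ) (hO S) (hO Sᶜ) (by
      intro u hu
      obtain ⟨k, hk⟩ : ∃ k, (w u : EuclideanSpace ℝ (Fin 4)) k ≠ 0 := by
        by_contra! h
        exact hwne u hu (by ext k; exact h k)
      obtain ⟨a, -, ha⟩ := exists_signedCoord_pos hk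
      by_cases h : a ∈ S
      · exact Or.inl ⟨a, h, ha⟩
      · exact Or.inr ⟨a, h, ha⟩) (hne S hpq hp) (hne Sᶜ hrs hr)
    obtain ⟨c, d, hcd, hmem⟩ := exists_adj_starGraph_mem_quadrant hN hcl (w u).2 (hlt u) (hwne u hu)
    have key : ∀ e : Fin 4 × Bool, 0 < signedCoord e (w u) → e = c ∨ e = d := fun e he => by
      by_contra! h
      linarith [signedCoord_nonpos_of_mem_quadrant h.1 h.2 hmem]
    rcases key a hau with rfl | rfl <;> rcases key b hbu with rfl | rfl
    exacts [hb ha, hb (hS _ _ ha hcd), hb (hS _ _ ha hcd.symm), hb ha]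
  · obtain ⟨u, hu⟩ := exists_ne (0 : EuclideanSpace ℝ (Fin 2))
    obtain ⟨p, q, hpq, -⟩ :=
      exists_adj_starGraph_mem_quadrant hN hcl (w u).2 (hlt u) (hwne u hu)
    exact ⟨p, q, hpq⟩

end

/-! ### The square faces, the squared-star and the squared-link in signed coordinates -/

theorem cubeNbhd_eq : cubeNbhd = {x | supNorm x ≤ 1} := by
  ext x
  simp only [mem_ofPred_eq, supNorm_le_iff zero_le_one]
  constructor
  · rintro ⟨_, ⟨⟨v, s, hs, rfl⟩, h0⟩, hx⟩ i
    have h1 := h0 i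
    have h2 := hx i
    have h3 : (if i ∈ s then (1 : ℝ) else 0) ≤ 1 := by split_ifs <;> norm_num
    have h4 : ((0 : EuclideanSpace ℝ (Fin 4)) i : ℝ) = 0 := rfl
    rw [h4] at h1
    rw [abs_le]
    constructor <;> linarith
  · intro hx
    have hex : ∀ i, ∃ n : ℤ, ((n : ℝ) ≤ x i ∧ x i ≤ n + 1) ∧ (n : ℝ) ≤ 0 ∧ 0 ≤ (n : ℝ) + 1 := by
      intro i
      have := abs_le.mp (hx i)
      rcases le_total 0 (x i) with h | h
      · exact ⟨0, by simp [h, this.2], by simp⟩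
      · exact ⟨-1, by simp [h, this.1], by simp⟩
    choose v hv using hex
    refine ⟨cubFace v Finset.univ, ⟨⟨v, _, by simp, rfl⟩, fun i => ?_⟩, fun i => ?_⟩ <;>
      rw [if_pos (Finset.mem_univ i)]
    exacts [(hv i).2, (hv i).1]

theorem cubeSphere_eq : cubeSphere = {x | supNorm x = 1} := by
  have hcl : IsClosed {x | supNorm x ≤ 1} := isClosed_le continuous_supNorm continuous_const
  rw [cubeSphere, cubeNbhd_eq, hcl.frontier_eq]
  ext x
  simp only [mem_sdiff, mem_ofPred_eq]
  constructor
  · rintro ⟨h1, h2⟩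
    refine le_antisymm h1 (not_lt.mp fun h => h2 ?_)
    exact mem_interior.mpr ⟨{x | supNorm x < 1}, fun y (hy : supNorm y < 1) => show _ ≤ _ from hy.le,
      isOpen_lt continuous_supNorm continuous_const, h⟩
  · intro h1
    refine ⟨h1.le, fun h => ?_⟩
    have hcont : Continuous fun ε : ℝ => (1 + ε) • x := by fun_prop
    have hlim := (hcont.tendsto 0).mono_left (nhdsWithin_le_nhds (s := Ioi 0))
    simp only [add_zero, one_smul] at hlim
    obtain ⟨ε, hε, hε0⟩ := ((hlim.eventually (mem_interior_iff_mem_nhds.mp h)).and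
      self_mem_nhdsWithin).exists
    have hε0 : 0 < ε := hε0
    have hε : supNorm ((1 + ε) • x) ≤ 1 := hε
    rw [supNorm_smul, h1, abs_of_pos (by linarith)] at hε
    linarith

theorem signedCoord_le_supNorm (p : Fin 4 × Bool) (x : EuclideanSpace ℝ (Fin 4)) :
    signedCoord p x ≤ supNorm x :=
  (le_abs_self _).trans (by
    rw [abs_signedCoord]; exact (supNorm_le_iff (supNorm_nonneg _)).mp le_rfl _)

theorem supNorm_eq_max_of_mem_quadrant {p q : Fin 4 × Bool} (hpq : p.1 ≠ q.1)
    {x : EuclideanSpace ℝ (Fin 4)} (hx : x ∈ quadrant p q) :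
    supNorm x = max (signedCoord p x) (signedCoord q x) := by
  conv_lhs => rw [← pairPoint_signedCoord hpq hx.2.2]
  rw [supNorm_pairPoint hpq, abs_of_nonneg hx.1, abs_of_nonneg hx.2.1]

/-- The lower end of the unit interval from `0` in direction `p`. -/
def lowerEnd (p : Fin 4 × Bool) : ℤ := if p.2 then 0 else -1

theorem unitQuad_eq_cubFace {p q : Fin 4 × Bool} (hpq : p.1 ≠ q.1) {v : Fin 4 → ℤ}
    (hp : v p.1 = lowerEnd p) (hq : v q.1 = lowerEnd q) (h : ∀ k, k ≠ p.1 → k ≠ q.1 → v k = 0) :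
    unitQuad p q = cubFace v {p.1, q.1} := by
  have key : ∀ (r : Fin 4 × Bool) (x : EuclideanSpace ℝ (Fin 4)),
      (lowerEnd r : ℝ) ≤ x r.1 ∧ x r.1 ≤ lowerEnd r + 1 ↔
        0 ≤ signedCoord r x ∧ signedCoord r x ≤ 1 := fun r x => by
    rcases r with ⟨i, _ | _⟩
    · simp [lowerEnd, signedCoord]; rw [and_comm, neg_le]
    · simp [lowerEnd, signedCoord]
  ext x
  constructor
  · rintro ⟨hx, hx1⟩ k
    by_cases h1 : k = p.1
    · subst h1
      simpa [hp] using (key p x).mpr ⟨hx.1, (signedCoord_le_supNorm _ _).trans hx1⟩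
    by_cases h2 : k = q.1
    · subst h2
      simpa [hq] using (key q x).mpr ⟨hx.2.1, (signedCoord_le_supNorm _ _).trans hx1⟩
    simp [h1, h2, h k h1 h2, hx.2.2 k h1 h2]
  · intro hx
    have h1 := (key p x).mp (by simpa [hp] using hx p.1)
    have h2 := (key q x).mp (by simpa [hq] using hx q.1)
    have h3 : x ∈ quadrant p q := by
      refine ⟨h1.1, h2.1, fun k hk hk' => ?_⟩
      have := hx k
      simp only [Finset.mem_insert, Finset.mem_singleton, hk, hk', or_self, if_false, h k hk hk',
        Int.cast_zero, add_zero] at this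
      exact le_antisymm this.2 this.1
    refine ⟨h3, ?_⟩
    rw [mem_ofPred_eq, supNorm_eq_max_of_mem_quadrant hpq h3]
    exact max_le h1.2 h2.2

theorem isCubFace_unitQuad {p q : Fin 4 × Bool} (hpq : p.1 ≠ q.1) :
    IsCubFace 2 (unitQuad p q) :=
  ⟨fun k => if k = p.1 then lowerEnd p else if k = q.1 then lowerEnd q else 0, {p.1, q.1},
    Finset.card_pair hpq, unitQuad_eq_cubFace hpq (by simp) (by simp [hpq.symm]) fun k h1 h2 => by
      simp [h1, h2]⟩

theorem zero_mem_unitQuad (p q : Fin 4 × Bool) : (0 : EuclideanSpace ℝ (Fin 4)) ∈ unitQuad p q := by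
  simp [unitQuad, quadrant]

/-- Containing the origin forces the lowest vertex to have coordinate `0` or `-1` along each edge
direction, which is the sign of the spanning vector, and `0` elsewhere. -/
theorem exists_eq_unitQuad {F : Set (EuclideanSpace ℝ (Fin 4))} (hF : IsCubFace 2 F)
    (h0 : (0 : EuclideanSpace ℝ (Fin 4)) ∈ F) :
    ∃ p q : Fin 4 × Bool, p.1 ≠ q.1 ∧ F = unitQuad p q := by
  obtain ⟨v, s, hs, rfl⟩ := hF
  obtain ⟨i, j, hij, rfl⟩ := Finset.card_eq_two.mp hs
  have hz : ∀ k, ((0 : EuclideanSpace ℝ (Fin 4)) k : ℝ) = 0 := fun k => rfl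
  have hlow : ∀ k ∈ ({i, j} : Finset (Fin 4)), ∃ r : Fin 4 × Bool, r.1 = k ∧ v k = lowerEnd r := by
    intro k hk
    have h1 := h0 k
    rw [hz, if_pos hk] at h1
    have h2 : (v k : ℝ) ≤ 0 := h1.1
    have h3 : (0 : ℝ) ≤ v k + 1 := h1.2
    have h2 : v k ≤ 0 := by exact_mod_cast h2
    have h3 : 0 ≤ v k + 1 := by exact_mod_cast h3
    by_cases h : v k = 0
    · exact ⟨(k, true), rfl, h⟩
    · exact ⟨(k, false), rfl, by simp only [lowerEnd, Bool.false_eq_true, if_false]; omega⟩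
  obtain ⟨p, rfl, hp⟩ := hlow i (by simp)
  obtain ⟨q, rfl, hq⟩ := hlow j (by simp)
  refine ⟨p, q, hij, (unitQuad_eq_cubFace hij hp hq fun k h1 h2 => ?_).symm⟩
  have h3 := h0 k
  rw [hz, if_neg (by simp [h1, h2]), add_zero] at h3
  have h4 : (v k : ℝ) = 0 := le_antisymm h3.1 h3.2
  exact_mod_cast h4

section

variable {N : Set (EuclideanSpace ℝ (Fin 4))}

theorem isStarFace_iff {F : Set (EuclideanSpace ℝ (Fin 4))} :
    IsStarFace N F ↔ ∃ p q, (starGraph N).Adj p q ∧ F = unitQuad p q := by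
  constructor
  · rintro ⟨h1, h2, h3⟩
    obtain ⟨p, q, hpq, rfl⟩ := exists_eq_unitQuad h1 h2
    exact ⟨p, q, ⟨hpq, h3⟩, rfl⟩
  · rintro ⟨p, q, hpq, rfl⟩
    exact ⟨isCubFace_unitQuad hpq.1, zero_mem_unitQuad p q, hpq.2⟩

theorem squaredStar_eq :
    squaredStar N = quadrantUnion {e | (starGraph N).Adj e.1 e.2} ∩ {x | supNorm x ≤ 1} := by
  ext x
  constructor
  · rintro ⟨F, hF, hx⟩
    obtain ⟨p, q, hpq, rfl⟩ := isStarFace_iff.mp hF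
    exact ⟨⟨(p, q), hpq, hx.1⟩, hx.2⟩
  · rintro ⟨⟨⟨p, q⟩, hpq, hx⟩, hx1⟩
    exact ⟨unitQuad p q, isStarFace_iff.mpr ⟨p, q, hpq, rfl⟩, hx, hx1⟩

theorem eq_or_eq_of_signedCoord_pos {p q r : Fin 4 × Bool} {x : EuclideanSpace ℝ (Fin 4)}
    (hx : x ∈ quadrant p q) (hr : 0 < signedCoord r x) : r = p ∨ r = q := by
  by_contra! h
  linarith [signedCoord_nonpos_of_mem_quadrant h.1 h.2 hx]

/-- The edge of the unit square spanned by `p` and `q` that is opposite to the edge `q`. -/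
theorem mem_squaredLink_of_signedCoord_eq_one {p q : Fin 4 × Bool} (hpq : (starGraph N).Adj p q)
    {x : EuclideanSpace ℝ (Fin 4)} (hx : x ∈ quadrant p q) (hx1 : supNorm x = 1)
    (hp : signedCoord p x = 1) : x ∈ squaredLink N := by
  let v : Fin 4 → ℤ := fun k =>
    if k = p.1 then (if p.2 then 1 else -1) else if k = q.1 then lowerEnd q else 0
  have hvp : v p.1 = if p.2 then 1 else -1 := by simp [v]
  have hvq : v q.1 = lowerEnd q := by simp [v, hpq.1.symm]
  have hmem : ∀ y, y ∈ cubFace v {q.1} ↔ signedCoord p y = 1 ∧ 0 ≤ signedCoord q y ∧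
      signedCoord q y ≤ 1 ∧ ∀ k, k ≠ p.1 → k ≠ q.1 → y k = 0 := by
    intro y
    have hqiff : (v q.1 : ℝ) ≤ y q.1 ∧ y q.1 ≤ (v q.1 : ℝ) + 1 ↔
        0 ≤ signedCoord q y ∧ signedCoord q y ≤ 1 := by
      rw [hvq]
      rcases q with ⟨i, _ | _⟩
      · simp [lowerEnd, signedCoord]; rw [and_comm, neg_le]
      · simp [lowerEnd, signedCoord]
    have hpiff : y p.1 = (v p.1 : ℝ) ↔ signedCoord p y = 1 := by
      rw [hvp]
      rcases p with ⟨i, _ | _⟩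
      · simp only [signedCoord, Bool.false_eq_true, if_false, Int.cast_neg, Int.cast_one]
        exact neg_eq_iff_eq_neg.symm
      · simp [signedCoord]
    constructor
    · intro h
      have h1 := h q.1
      rw [if_pos (by simp), hqiff] at h1
      have h2 := h p.1
      rw [if_neg (by simpa using hpq.1), add_zero] at h2
      refine ⟨hpiff.mp (le_antisymm h2.2 h2.1), h1.1, h1.2, fun k hk hk' => ?_⟩
      have h3 := h k
      rw [if_neg (by simpa using hk'), add_zero] at h3
      have h4 : v k = 0 := by simp [v, hk, hk']
      rw [h4, Int.cast_zero] at h3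
      exact le_antisymm h3.2 h3.1
    · rintro ⟨h1, h2, h3, h4⟩ k
      by_cases hk' : k = q.1
      · rw [hk', if_pos (by simp)]
        exact hqiff.mpr ⟨h2, h3⟩
      rw [if_neg (by simpa using hk'), add_zero]
      by_cases hk : k = p.1
      · rw [hk, hpiff.mpr h1]; exact ⟨le_rfl, le_rfl⟩
      · have h5 : v k = 0 := by simp [v, hk, hk']
        rw [h5, h4 k hk hk']; simp
  refine ⟨cubFace v {q.1}, ⟨⟨v, {q.1}, by simp, rfl⟩, unitQuad p q,
    ⟨isStarFace_iff.mpr ⟨p, q, hpq, rfl⟩, ?_⟩, ?_⟩, ?_⟩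
  · intro y hy
    obtain ⟨h1, h2, h3, h4⟩ := (hmem y).mp hy
    have hy : y ∈ quadrant p q := ⟨by rw [h1]; exact zero_le_one, h2, h4⟩
    refine ⟨hy, ?_⟩
    rw [mem_ofPred_eq, supNorm_eq_max_of_mem_quadrant hpq.1 hy]
    exact max_le h1.le h3
  · rintro F ⟨hF, heF⟩
    obtain ⟨p', q', hpq', rfl⟩ := isStarFace_iff.mp hF
    -- The corner of the outer edge has positive `p`- and `q`-coordinates, so any star face
    -- containing it is spanned by `p` and `q`.
    have hc : pairPoint p q 1 1 ∈ unitQuad p' q' := by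
      refine heF ((hmem _).mpr ?_)
      rw [signedCoord_pairPoint_left hpq.1, signedCoord_pairPoint_right hpq.1]
      exact ⟨rfl, zero_le_one, le_rfl, fun k h1 h2 => pairPoint_apply_of_ne _ _ h1 h2⟩
    have h1 := eq_or_eq_of_signedCoord_pos hc.1 (r := p)
      (by rw [signedCoord_pairPoint_left hpq.1]; exact one_pos)
    have h2 := eq_or_eq_of_signedCoord_pos hc.1 (r := q)
      (by rw [signedCoord_pairPoint_right hpq.1]; exact one_pos)
    have hne := hpq.ne
    rcases h1 with rfl | rfl <;> rcases h2 with rfl | rfl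
    · exact absurd rfl hne
    · rfl
    · rw [unitQuad, quadrant_comm, unitQuad]
    · exact absurd rfl hne
  · exact (hmem x).mpr ⟨hp, hx.2.1, (signedCoord_le_supNorm _ _).trans hx1.le, hx.2.2⟩

/-- An edge of a star face either lies on `∂D`, where its outer corner determines the face, or
issues from the origin, where the two neighbours of its direction give two faces; only the first
kind belongs to the link. -/
theorem squaredLink_eq (hG : IsDirectionCycle (starGraph N)) :
    squaredLink N = quadrantUnion {e | (starGraph N).Adj e.1 e.2} ∩ {x | supNorm x = 1} := by
  ext x
  constructor
  · rintro ⟨_, ⟨⟨v, s, hs, rfl⟩, F, ⟨hF, heF⟩, huniq⟩, hx⟩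
    obtain ⟨i, rfl⟩ := Finset.card_eq_one.mp hs
    obtain ⟨p, q, hpq, rfl⟩ := isStarFace_iff.mp hF
    refine ⟨⟨(p, q), hpq, (heF hx).1⟩, (heF hx).2.antisymm (not_lt.mp fun hlt => ?_)⟩
    rw [supNorm_lt_iff one_pos] at hlt
    have hoff : ∀ y ∈ cubFace v {i}, ∀ k, k ≠ i → y k = (v k : ℝ) := fun y hy k hk => by
      have := hy k
      rw [if_neg (by simpa using hk), add_zero] at this
      exact le_antisymm this.2 this.1
    -- A point of sup norm below `1` forces the constant integer coordinates of the edge to vanish,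
    -- so the edge lies on an axis and, inside `D`, issues from the origin.
    have hv : ∀ k, k ≠ i → v k = 0 := fun k hk => by
      have h1 : |(v k : ℝ)| < 1 := by rw [← hoff x hx k hk]; exact hlt k
      exact Int.abs_lt_one_iff.mp (by exact_mod_cast h1)
    have hends : ∀ t : ℝ, (v i : ℝ) ≤ t → t ≤ (v i : ℝ) + 1 →
        EuclideanSpace.single i t ∈ cubFace v {i} := fun t h1 h2 k => by
      by_cases hk : k = i
      · subst hk; simp [h1, h2]
      · simp [hk, hv k hk]
    have habs : ∀ t : ℝ, (v i : ℝ) ≤ t → t ≤ (v i : ℝ) + 1 → |t| ≤ 1 := fun t h1 h2 => by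
      simpa using (supNorm_le_iff zero_le_one).mp (heF (hends t h1 h2)).2 i
    have hvi : v i = 0 ∨ v i = -1 := by
      have h1 := abs_le.mp (habs _ le_rfl (by linarith))
      have h2 := abs_le.mp (habs _ (by linarith) le_rfl)
      have h3 : (-1 : ℤ) ≤ v i := by exact_mod_cast h1.1
      have h4 : v i + 1 ≤ 1 := by exact_mod_cast h2.2
      omega
    obtain ⟨r, hri, hr⟩ : ∃ r : Fin 4 × Bool, r.1 = i ∧ v i = lowerEnd r := by
      rcases hvi with h | h
      · exact ⟨(i, true), rfl, by simp [h, lowerEnd]⟩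
      · exact ⟨(i, false), rfl, by simp [h, lowerEnd]⟩
    have hunit : signedUnit r ∈ cubFace v {i} := by
      rcases r with ⟨i', _ | _⟩ <;> obtain rfl : i' = i := hri <;>
        refine hends _ ?_ ?_ <;> rw [hr] <;> simp [lowerEnd]
    have hrange : ∀ y ∈ cubFace v {i}, 0 ≤ signedCoord r y ∧ ∀ k, k ≠ r.1 → y k = 0 := by
      intro y hy
      have h1 := hy i
      rw [if_pos (by simp), hr] at h1
      refine ⟨?_, fun k hk => ?_⟩
      · rcases r with ⟨i', _ | _⟩ <;> obtain rfl : i' = i := hri <;>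
          simp [lowerEnd, signedCoord] at h1 ⊢
        exacts [h1.2, h1.1]
      · rw [hoff y hy k (hri ▸ hk), hv k (hri ▸ hk), Int.cast_zero]
    obtain ⟨q₁, hrq₁⟩ : ∃ q₁, (starGraph N).Adj r q₁ := by
      rcases eq_or_eq_of_signedCoord_pos (heF hunit).1 (r := r) (by simp) with rfl | rfl
      exacts [⟨q, hpq⟩, ⟨p, hpq.symm⟩]
    obtain ⟨q₂, hq₂, h₂⟩ := hG.exists_other hrq₁
    have hrq₂ := (h₂ q₂).mpr (Or.inr rfl)
    have hsub : ∀ q', (starGraph N).Adj r q' → unitQuad r q' = unitQuad p q := fun q' hq' => by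
      refine huniq _ ⟨isStarFace_iff.mpr ⟨r, q', hq', rfl⟩, fun y hy => ⟨⟨(hrange y hy).1, ?_,
        fun k hk _ => (hrange y hy).2 k hk⟩, (heF hy).2⟩⟩
      exact (signedCoord_eq_zero_iff.mpr ((hrange y hy).2 _ hq'.1.symm)).ge
    -- Uniqueness would identify the squares of `q₁` and `q₂`; the corner of the first is not in the
    -- second.
    have hmem : pairPoint r q₁ 1 1 ∈ unitQuad r q₂ := by
      rw [hsub q₂ hrq₂, ← hsub q₁ hrq₁]
      exact pairPoint_mem_unitQuad hrq₁.1 zero_le_one zero_le_one le_rfl le_rfl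
    rcases eq_or_eq_of_signedCoord_pos hmem.1 (r := q₁)
      (by rw [signedCoord_pairPoint_right hrq₁.1]; exact one_pos) with h | h
    · exact hrq₁.ne h.symm
    · exact hq₂ h.symm
  · rintro ⟨⟨⟨p, q⟩, hpq, hx⟩, hx1⟩
    have h := supNorm_eq_max_of_mem_quadrant hpq.1 hx
    rw [hx1] at h
    rcases max_choice (signedCoord p x) (signedCoord q x) with h' | h'
    · exact mem_squaredLink_of_signedCoord_eq_one hpq hx hx1 (by rw [← h', h])
    · exact mem_squaredLink_of_signedCoord_eq_one hpq.symm (quadrant_comm p q ▸ hx) hx1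
        (by rw [← h', h])

end

/-! ### The flat square -/

theorem flatSquare_eq (i j : Fin 4) : flatSquare i j = coordPlane i j ∩ {x | supNorm x ≤ 1} := by
  ext x
  simp only [flatSquare, coordPlane, mem_inter_iff, mem_ofPred_eq, supNorm_le_iff zero_le_one]
  constructor
  · rintro ⟨h1, h2, h3⟩
    refine ⟨h3, fun k => ?_⟩
    by_cases hi : k = i
    · rwa [hi]
    by_cases hj : k = j
    · rwa [hj]
    · rw [h3 k hi hj]; simp
  · rintro ⟨h1, h2⟩
    exact ⟨h2 i, h2 j, h1⟩

theorem supNorm_eq_max_of_mem_coordPlane {i j : Fin 4} {x : EuclideanSpace ℝ (Fin 4)}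
    (hx : x ∈ coordPlane i j) : supNorm x = max |x i| |x j| := by
  refine le_antisymm ((supNorm_le_iff (by positivity)).mpr fun k => ?_) (max_le ?_ ?_)
  · by_cases hi : k = i
    · rw [hi]; exact le_max_left _ _
    by_cases hj : k = j
    · rw [hj]; exact le_max_right _ _
    · rw [hx k hi hj, abs_zero]; positivity
  all_goals exact (supNorm_le_iff (supNorm_nonneg _)).mp le_rfl _

theorem flatSquareBoundary_eq (i j : Fin 4) :
    flatSquareBoundary i j = coordPlane i j ∩ {x | supNorm x = 1} := by
  ext x
  simp only [flatSquareBoundary, flatSquare_eq, mem_inter_iff, mem_ofPred_eq]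
  constructor
  · rintro ⟨⟨h1, h2⟩, h3⟩
    refine ⟨h1, h2.antisymm ?_⟩
    rw [supNorm_eq_max_of_mem_coordPlane h1]
    rcases h3 with h3 | h3
    · exact h3.ge.trans (le_max_left _ _)
    · exact h3.ge.trans (le_max_right _ _)
  · rintro ⟨h1, h2⟩
    refine ⟨⟨h1, h2.le⟩, ?_⟩
    rw [supNorm_eq_max_of_mem_coordPlane h1] at h2
    rcases max_choice |x i| |x j| with h | h
    · exact Or.inl (by rw [← h, h2])
    · exact Or.inr (by rw [← h, h2])

/-- Central projection: a point of the circle is divided by its sup norm, and a point of the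
perimeter comes from its quotient by the Euclidean norm. -/
theorem isSimpleClosedCurve_flatSquareBoundary {i j : Fin 4} (hij : i ≠ j) :
    IsSimpleClosedCurve (flatSquareBoundary i j) := by
  have hpq : ((i, true) : Fin 4 × Bool).1 ≠ ((j, true) : Fin 4 × Bool).1 := hij
  let m : Circle → ℝ := fun z => max |(z : ℂ).re| |(z : ℂ).im|
  have hm : ∀ z, 0 < m z := fun z => by
    by_contra! h
    have h1 : (z : ℂ).re = 0 := abs_nonpos_iff.mp ((le_max_left _ _).trans h)
    have h2 : (z : ℂ).im = 0 := abs_nonpos_iff.mp ((le_max_right _ _).trans h)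
    exact z.coe_ne_zero (Complex.ext h1 h2)
  have hre : Continuous fun z : Circle => (z : ℂ).re :=
    Complex.continuous_re.comp continuous_subtype_val
  have him : Continuous fun z : Circle => (z : ℂ).im :=
    Complex.continuous_im.comp continuous_subtype_val
  have hmc : Continuous m := hre.abs.max him.abs
  have hsq : ∀ z : Circle, (z : ℂ).re ^ 2 + (z : ℂ).im ^ 2 = 1 := fun z => by
    have := Circle.normSq_coe z
    rw [Complex.normSq_apply] at this
    linarith
  refine ⟨fun z => pairPoint (i, true) (j, true) ((z : ℂ).re / m z) ((z : ℂ).im / m z),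
    continuous_pairPoint _ _ (hre.div hmc fun z => (hm z).ne') (him.div hmc fun z => (hm z).ne'),
    fun z z' h => ?_, ?_⟩
  · have h1 := congrArg (signedCoord (i, true)) h
    have h2 := congrArg (signedCoord (j, true)) h
    simp only [signedCoord_pairPoint_left hpq, signedCoord_pairPoint_right hpq] at h1 h2
    have hz := hm z
    have hz' := hm z'
    rw [div_eq_div_iff hz.ne' hz'.ne'] at h1 h2
    -- Equal images give proportional points of the unit circle; squaring and adding the
    -- cross-multiplied equations makes the scale factors equal.
    have h3 : m z' ^ 2 = m z ^ 2 := by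
      calc m z' ^ 2 = ((z : ℂ).re * m z') ^ 2 + ((z : ℂ).im * m z') ^ 2 := by
            linear_combination (-m z' ^ 2) * hsq z
        _ = m z ^ 2 := by rw [h1, h2]; linear_combination (m z ^ 2) * hsq z'
    have h4 : m z' = m z := by
      rwa [sq_eq_sq₀ hz'.le hz.le] at h3
    rw [h4] at h1 h2
    exact Circle.ext (Complex.ext (mul_right_cancel₀ hz.ne' h1) (mul_right_cancel₀ hz.ne' h2))
  · rw [flatSquareBoundary_eq]
    ext x
    constructor
    · rintro ⟨z, rfl⟩
      refine ⟨fun k h1 h2 => pairPoint_apply_of_ne _ _ h1 h2, ?_⟩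
      have hz := hm z
      rw [mem_ofPred_eq, supNorm_pairPoint hpq, abs_div, abs_div, abs_of_pos hz,
        max_div_div_right hz.le]
      exact div_self hz.ne'
    · rintro ⟨h1, h2⟩
      have hx0 : (⟨x i, x j⟩ : ℂ) ≠ 0 := fun h => by
        have hi : x i = 0 := congrArg Complex.re h
        have hj : x j = 0 := congrArg Complex.im h
        rw [mem_ofPred_eq, supNorm_eq_max_of_mem_coordPlane h1, hi, hj] at h2
        simp at h2
      have hn := norm_pos_iff.mpr hx0
      set n := ‖(⟨x i, x j⟩ : ℂ)‖
      let z : Circle := ⟨(⟨x i, x j⟩ : ℂ) / n, by simp [Submonoid.unitSphere, n, hn.ne']⟩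
      have hzre : (z : ℂ).re = x i / n := by simp [z, Complex.div_ofReal_re]
      have hzim : (z : ℂ).im = x j / n := by simp [z, Complex.div_ofReal_im]
      have hmz : m z = 1 / n := by
        simp only [m, hzre, hzim, abs_div, abs_of_pos hn, max_div_div_right hn.le]
        rw [← supNorm_eq_max_of_mem_coordPlane h1, h2]
      refine ⟨z, ?_⟩
      simp only [hzre, hzim, hmz]
      have e : ∀ t : ℝ, t / n / (1 / n) = t := fun t => by field_simp
      rw [e, e]
      exact pairPoint_signedCoord hpq h1

theorem IsSimpleClosedCurve.image {X Y : Type*} [TopologicalSpace X] [TopologicalSpace Y]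
    {K : Set X} (hK : IsSimpleClosedCurve K) (e : X ≃ₜ Y) : IsSimpleClosedCurve (e '' K) := by
  obtain ⟨γ, h1, h2, rfl⟩ := hK
  exact ⟨e ∘ γ, e.continuous.comp h1, e.injective.comp h2, range_comp _ _⟩

/-- The restriction of an ambient isotopy to an invariant subset. -/
def AmbientIsotopy.restrict {X : Type*} [TopologicalSpace X] (H : AmbientIsotopy X) (S : Set X)
    (hS : ∀ t x, x ∈ S ↔ H.homeo t x ∈ S) : AmbientIsotopy S where
  homeo t := (H.homeo t).subtype (hS t)
  continuous_homeo := by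
    refine Continuous.subtype_mk (H.continuous_homeo.comp
      (continuous_fst.prodMk (continuous_subtype_val.comp continuous_snd))) _
  continuous_symm := by
    refine Continuous.subtype_mk (H.continuous_symm.comp
      (continuous_fst.prodMk (continuous_subtype_val.comp continuous_snd))) _
  homeo_zero := by
    ext x
    change (H.homeo 0) x = x
    rw [H.homeo_zero]; rfl

theorem mainTheorem3 (N : Set (EuclideanSpace ℝ (Fin 4))) (hN : IsGriddedSurface N)
    (hclosed : IsClosed N) (h0 : (0 : EuclideanSpace ℝ (Fin 4)) ∈ N) :
    IsSimpleClosedCurve (squaredLink N) ∧ IsUnknotted (squaredLink N) ∧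
      ∃ i j : Fin 4, i ≠ j ∧ ∃ H : AmbientIsotopy (EuclideanSpace ℝ (Fin 4)),
        (∀ t, H.homeo t 0 = 0 ∧ H.homeo t '' cubeNbhd = cubeNbhd) ∧
        H.homeo 1 '' squaredStar N = flatSquare i j ∧
        H.homeo 1 '' squaredLink N = flatSquareBoundary i j := by
  have hG := isDirectionCycle_starGraph hN hclosed h0
  obtain ⟨i, j, hij, H, hH, himg⟩ := hG.supNormIsotopic
  -- Every set defined by the sup norm alone is invariant; this serves for both `D` and `∂D`.
  have hpres : ∀ (t : unitInterval) (P : ℝ → Prop),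
      H.homeo t '' {x | P (supNorm x)} = {x | P (supNorm x)} := fun t P => by
    ext x
    constructor
    · rintro ⟨y, hy, rfl⟩
      rw [mem_ofPred_eq, hH]; exact hy
    · intro hx
      refine ⟨(H.homeo t).symm x, ?_, (H.homeo t).apply_symm_apply x⟩
      rw [mem_ofPred_eq, ← hH t, (H.homeo t).apply_symm_apply]; exact hx
  have hlink : H.homeo 1 '' squaredLink N = flatSquareBoundary i j := by
    rw [squaredLink_eq hG, image_inter (H.homeo 1).injective, himg, hpres 1 (· = 1),
      flatSquareBoundary_eq]
  have hstar : H.homeo 1 '' squaredStar N = flatSquare i j := by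
    rw [squaredStar_eq, image_inter (H.homeo 1).injective, himg, hpres 1 (· ≤ 1), flatSquare_eq]
  have hsphere : squaredLink N ⊆ cubeSphere := by
    rw [squaredLink_eq hG, cubeSphere_eq]; exact inter_subset_right
  refine ⟨?_, ⟨hsphere, i, j, hij, H.restrict cubeSphere fun t x => ?_, ?_⟩, i, j, hij, H,
    fun t => ⟨?_, ?_⟩, hstar, hlink⟩
  · have := (isSimpleClosedCurve_flatSquareBoundary hij).image (H.homeo 1).symm
    rwa [← hlink, ← image_comp, (H.homeo 1).symm_comp_self, image_id] at this
  · rw [cubeSphere_eq, mem_ofPred_eq, mem_ofPred_eq, hH]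
  · rw [← hlink]
    ext x
    constructor
    · rintro ⟨_, ⟨y, hy, rfl⟩, rfl⟩
      exact ⟨y, hy, rfl⟩
    · rintro ⟨y, hy, rfl⟩
      exact ⟨_, ⟨⟨y, hsphere hy⟩, hy, rfl⟩, rfl⟩
  · rw [← supNorm_eq_zero_iff, hH, supNorm_zero]
  · rw [cubeNbhd_eq]; exact hpres t (· ≤ 1)
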